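/- Let $\theta>0$ and let $\alpha=s/t$ be a rational number in reduced form ($s\in\mathbb{Z}$, $t\ge 1$, $\gcd(s,t)=1$). For each $n$ let $\sigma$ be a random permutation in the symmetric group $\mathfrak{S}_n$ with the Ewens distribution of parameter $\theta$, that is, $\sigma$ has probability $\theta^{K(\sigma)}/(\theta(\theta+1)\cdots(\theta+n-1))$, where $K(\sigma)$ is the number of cycles of $\sigma$ (fixed points included). Let $C_j^{(n)}$ be the number of cycles of $\sigma$ of length $j$, and set $$\mathfrak{E}_n^\alpha=\sum_{j=1}^n C_j^{(n)}\sum_{i\in\mathbb{Z}}\delta_{n(i/j-\alpha)} .$$ Let $(L_1,L_2,\dots)$ have the Poisson–Dirichlet distribution $PD(\theta)$, i.e. the law of the decreasing order statistics of $V_j=W_j\prod_{i<j}(1-W_i)$, where $W_1,W_2,\dots$ are i.i.d. with density $\theta(1-x)^{\theta-1}$ on $[0,1]$. Let $U_1,U_2,\dots$ be i.i.d. uniform on $\{1/t,2/t,\dots,1\}$ and independent of $(L_1,L_2,\dots)$, and set $$\mathfrak{E}_\infty^t=\sum_{i=1}^\infty\sum_{q\in\mathbb{Z}}\delta_{(U_i+q)/L_i}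 .$$ Then $\mathfrak{E}_n^\alpha\to\mathfrak{E}_\infty^t$ weakly in the following sense: for every continuous, compactly supported $f:\mathbb{R}\to\mathbb{R}$, the function $f$ is integrable with respect to every realization of $\mathfrak{E}_n^\alpha$, the integral $\int f\,d\mathfrak{E}_\infty^t=\int f^+\,d\mathfrak{E}_\infty^t-\int f^-\,d\mathfrak{E}_\infty^t$ is almost surely well defined in $\overline{\mathbb{R}}=\mathbb{R}\cup\{\pm\infty\}$ (at least one of the two terms is finite), and, as $n\to\infty$, $\int f\,d\mathfrak{E}_n^\alpha\to\int f\,d\mathfrak{E}_\infty^t$ in distribution as $\overline{\mathbb{R}}$-valued random variables. -/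

import Mathlib

open MeasureTheory ProbabilityTheory Filter
open scoped ENNReal

/-- The number `K(σ)` of cycles of a permutation of `{1, …, n}`, fixed points included: the number
of parts of the partition of `n` formed by the cycle lengths. -/
def numCycles {n : ℕ} (σ : Equiv.Perm (Fin n)) : ℕ := Multiset.card σ.partition.parts

/-- The number `C_j(σ)` of cycles of `σ` of length `j` (fixed points are cycles of length `1`). -/
def cycleCount {n : ℕ} (j : ℕ) (σ : Equiv.Perm (Fin n)) : ℕ := σ.partition.parts.count j

theorem numCycles_eq {n : ℕ} (σ : Equiv.Perm (Fin n)) :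
    numCycles σ = Multiset.card σ.cycleType + (n - σ.support.card) := by
  simp [numCycles, Equiv.Perm.parts_partition]

theorem card_support_le' {n : ℕ} (σ : Equiv.Perm (Fin n)) : σ.support.card ≤ n := by
  simpa using Finset.card_le_univ σ.support

/-- Multiplying by the transposition `(a σ(a))` splits off the point `a` as a fixed point. -/
theorem numCycles_swap_mul {n : ℕ} (ρ : Equiv.Perm (Fin n)) (a : Fin n) (ha : ρ a ≠ a) :
    numCycles (Equiv.swap a (ρ a) * ρ) = numCycles ρ + 1 := by
  classical
  set c := ρ.cycleOf a with hc
  have hcy : c.IsCycle := Equiv.Perm.isCycle_cycleOf ρ ha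
  have hmem : c ∈ ρ.cycleFactorsFinset := by
    rw [hc, Equiv.Perm.cycleOf_mem_cycleFactorsFinset_iff]
    exact Equiv.Perm.mem_support.2 ha
  have hdis : (ρ * c⁻¹).Disjoint c := Equiv.Perm.disjoint_mul_inv_of_mem_cycleFactorsFinset hmem
  set r := ρ * c⁻¹ with hr
  have hρ : ρ = c * r := by
    rw [← hdis.commute.eq, hr]; group
  have hca : c a = ρ a := Equiv.Perm.cycleOf_apply_self ρ a
  have hcane : c a ≠ a := by rw [hca]; exact ha
  have hsw : Equiv.swap a (ρ a) * ρ = (Equiv.swap a (c a) * c) * r := by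
    rw [hca, mul_assoc, ← hρ]
  have hsub : (Equiv.swap a (c a) * c).support ⊆ c.support := by
    intro x hx
    exact Equiv.Perm.mem_support.2
      (Equiv.Perm.ne_and_ne_of_swap_mul_apply_ne_self (Equiv.Perm.mem_support.1 hx)).1
  have hdis' : (Equiv.swap a (c a) * c).Disjoint r := by
    rw [Equiv.Perm.disjoint_iff_disjoint_support]
    exact Disjoint.mono_left hsub (Equiv.Perm.disjoint_iff_disjoint_support.1 hdis.symm)
  have hle := card_support_le' ρ
  have h1 : numCycles ρ = 1 + Multiset.card r.cycleType + (n - (c.support.card + r.support.card)) := by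
    rw [numCycles_eq]
    conv_lhs => rw [hρ]
    rw [hdis.symm.cycleType_mul, hdis.symm.card_support_mul, hcy.cycleType]
    simp [add_comm]
  have h1' : c.support.card + r.support.card ≤ n := by
    rw [← hdis.symm.card_support_mul, ← hρ]; exact hle
  have h2 : 2 ≤ c.support.card := hcy.two_le_card_support
  rw [hsw, numCycles_eq, hdis'.cycleType_mul, hdis'.card_support_mul, h1]
  by_cases hcc : c (c a) = a
  · have hcs : c = Equiv.swap a (c a) := hcy.eq_swap_of_apply_apply_eq_self hcane hcc
    have h3 : Equiv.swap a (c a) * c = 1 := by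
      conv_lhs => rw [← hcs]
      rw [hcs]; simp
    have h4 : c.support.card = 2 := by
      rw [hcs]; exact Equiv.Perm.card_support_swap hcane.symm
    rw [h3]
    simp
    omega
  · have h3 := hcy.swap_mul hcane hcc
    have h4 : (Equiv.swap a (c a) * c).support.card = c.support.card - 1 := by
      rw [Equiv.Perm.support_swap_mul_eq _ _ hcc, Finset.card_sdiff_of_subset]
      · simp
      · simpa using hcane
    rw [h3.cycleType, h4]
    simp
    omega

theorem numCycles_decomposeFin_zero {n : ℕ} (σ : Equiv.Perm (Fin n)) :
    numCycles (Equiv.Perm.decomposeFin.symm (0, σ)) = numCycles σ + 1 := by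
  have h : Equiv.Perm.decomposeFin.symm (0, σ)
      = σ.extendDomain (finSuccAboveEquiv (0 : Fin (n + 1))) := by
    ext x
    refine Fin.cases ?_ (fun i => ?_) x
    · rw [Equiv.Perm.decomposeFin_symm_apply_zero,
        Equiv.Perm.extendDomain_apply_not_subtype _ _ (by simp)]
    · have := Equiv.Perm.extendDomain_apply_image σ (finSuccAboveEquiv (0 : Fin (n + 1))) i
      simp only [finSuccAboveEquiv_apply, Fin.zero_succAbove] at this
      rw [this, Equiv.Perm.decomposeFin_symm_apply_succ]
      simp
  have hl := card_support_le' σ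
  rw [numCycles_eq, numCycles_eq, h, Equiv.Perm.cycleType_extendDomain,
    Equiv.Perm.card_support_extend_domain]
  omega

theorem numCycles_decomposeFin_ne {n : ℕ} (σ : Equiv.Perm (Fin n)) (p : Fin (n + 1))
    (hp : p ≠ 0) : numCycles (Equiv.Perm.decomposeFin.symm (p, σ)) = numCycles σ := by
  have h0 : Equiv.Perm.decomposeFin.symm (p, σ) 0 = p :=
    Equiv.Perm.decomposeFin_symm_apply_zero p σ
  have h := numCycles_swap_mul (Equiv.Perm.decomposeFin.symm (p, σ)) 0 (by rw [h0]; exact hp)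
  have h2 : Equiv.swap 0 p * Equiv.Perm.decomposeFin.symm (p, σ)
      = Equiv.Perm.decomposeFin.symm (0, σ) := by
    ext x
    refine Fin.cases ?_ (fun i => ?_) x
    · simp
    · simp [Equiv.Perm.decomposeFin_symm_apply_succ]
  rw [h0, h2, numCycles_decomposeFin_zero] at h
  omega

theorem sum_pow_numCycles (θ : ℝ) (n : ℕ) :
    ∑ σ : Equiv.Perm (Fin n), θ ^ numCycles σ = ∏ i ∈ Finset.range n, (θ + i) := by
  induction n with
  | zero => simp [numCycles_eq]
  | succ n ih =>
    rw [← Equiv.sum_comp Equiv.Perm.decomposeFin.symm, Fintype.sum_prod_type, Fin.sum_univ_succ]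
    simp only [numCycles_decomposeFin_zero, numCycles_decomposeFin_ne _ _ (Fin.succ_ne_zero _),
      pow_succ, ← Finset.sum_mul, ih, Finset.sum_const, Finset.card_univ, Fintype.card_fin,
      nsmul_eq_mul, Finset.prod_range_succ]
    ring

/-- All subsets of the finite symmetric group are measurable. -/
instance permFinMeasurableSpace (n : ℕ) : MeasurableSpace (Equiv.Perm (Fin n)) := ⊤

/-- The Ewens distribution with parameter `θ > 0` on the symmetric group:
`σ` has probability `θ ^ K(σ) / (θ (θ + 1) ⋯ (θ + n - 1))`. -/
noncomputable def ewens (θ : ℝ) (hθ : 0 < θ) (n : ℕ) : PMF (Equiv.Perm (Fin n)) :=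
  PMF.ofFintype
    (fun σ => ENNReal.ofReal (θ ^ numCycles σ / ∏ i ∈ Finset.range n, (θ + i)))
    (by
      have hpos : 0 < ∏ i ∈ Finset.range n, (θ + i) :=
        Finset.prod_pos fun i _ => by positivity
      rw [← ENNReal.ofReal_sum_of_nonneg fun σ _ => by positivity, ← Finset.sum_div,
        sum_pow_numCycles, div_self hpos.ne', ENNReal.ofReal_one])

/-- The point process of scaled eigenangles of the permutation matrix of `σ`, seen from `α`:
`∑_{j=1}^n C_j(σ) ∑_{i ∈ ℤ} δ_{n (i / j - α)}`. -/
noncomputable def eigenProcess (α : ℝ) (n : ℕ) (σ : Equiv.Perm (Fin n)) : Measure ℝ :=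
  ∑ j ∈ Finset.Icc 1 n, cycleCount j σ •
    Measure.sum fun i : ℤ => Measure.dirac ((n : ℝ) * ((i : ℝ) / (j : ℝ) - α))

/-- The stick-breaking map `(w_i) ↦ (w_i ∏_{j < i} (1 - w_j))`. -/
noncomputable def stickBreaking (w : ℕ → ℝ) : ℕ → ℝ :=
  fun i => w i * ∏ j ∈ Finset.range i, (1 - w j)

/-- Decreasing order statistics: the entry of index `i` is the `(i + 1)`-st largest entry of `v`
(for a sequence of positive numbers tending to zero), that is, the maximum of `min_{j ∈ s} v j`
over all sets `s` of `i + 1` indices. -/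
noncomputable def decreasingRearrangement (v : ℕ → ℝ) : ℕ → ℝ :=
  fun i => ⨆ s : {s : Finset ℕ // s.card = i + 1},
    s.1.inf' (Finset.card_pos.1 (by rw [s.2]; exact Nat.succ_pos i)) v

/-- The `GEM(θ)` distribution: stick breaking with i.i.d. variables of density
`θ (1 - x) ^ (θ - 1)` on `[0, 1]`. -/
noncomputable def gemMeasure (θ : ℝ) : Measure (ℕ → ℝ) :=
  (Measure.infinitePi fun _ : ℕ => betaMeasure 1 θ).map stickBreaking

/-- The Poisson–Dirichlet distribution `PD(θ)`: the law of the decreasing order statistics of a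
`GEM(θ)` sequence. -/
noncomputable def poissonDirichlet (θ : ℝ) : Measure (ℕ → ℝ) :=
  (gemMeasure θ).map decreasingRearrangement

/-- The measure `∑_i ∑_{q ∈ ℤ} δ_{(u_i + q) / l_i}`. -/
noncomputable def limitProcess (l u : ℕ → ℝ) : Measure ℝ :=
  Measure.sum fun i : ℕ => Measure.sum fun q : ℤ => Measure.dirac ((u i + (q : ℝ)) / l i)

/-- The uniform distribution on `{1/t, 2/t, …, 1}`. -/
noncomputable def uniformFractions (t : ℕ) : Measure ℝ :=
  uniformOn ((fun m : ℕ => (m : ℝ) / (t : ℝ)) '' Set.Icc 1 t)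

/-- The extended-real integral `∫ f dμ = ∫ f⁺ dμ - ∫ f⁻ dμ`, meaningful when at least one of the
two terms is finite. -/
noncomputable def extIntegral (μ : Measure ℝ) (f : ℝ → ℝ) : EReal :=
  ((∫⁻ x, ENNReal.ofReal (f x) ∂μ : ℝ≥0∞) : EReal) -
    ((∫⁻ x, ENNReal.ofReal (-f x) ∂μ : ℝ≥0∞) : EReal)

/-!
The cycle lengths of an Ewens permutation are peeled off one at a time. For a sequence `F`, write
`E_n(F)` for the Ewens expectation of `∏ F(ℓ)` over the cycle lengths `ℓ`. The numbers `E_n(F)` are,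
up to normalisation, the coefficients of `exp (θ ∑ ℓ, F(ℓ) z ^ ℓ / ℓ)`, and Newton's recursion for
these coefficients (`ewensProduct_eq_sum`) reads `E_m(F) = ∑ ℓ, p_m(ℓ) F(ℓ) E_{m-ℓ}(F)`, where `p_m`
is the law of the length of the cycle of a given point. This kernel is a mixture of binomial weights
over the beta law of the first stick `W₁`, so `ℓ / m` converges to `W₁`; and since `p_m` is monotone
in `ℓ`, the residue of `ℓ` modulo `t` becomes uniform and asymptotically independent of `ℓ / m`
(`tendsto_sum_cycleKernel_periodic`).

If `F(ℓ) = Φ(ℓ / n, ℓ mod t)` with `|Φ| ≤ 1` and `Φ = 1` on sizes at most `ε`, the limit of `E_n(F)`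
is obtained by iterating the operator `h ↦ (x ↦ E[φ(x W₁) h(x (1 - W₁))])`, where `φ` is the mean of
`Φ` over the residues. One step of the recursion costs a small error `D` only when more than `ε n`
points remain, and a multiple of `m / n` is a supersolution of the recursion satisfied by the
accumulated error; hence the errors do not add up (`norm_ewensProduct_sub_stickIterate_le`). The
iterates are expectations of `∏ φ(V_j)` over stick-breaking sequences `V`. Such products ignore the
order of the factors, so `V` may be replaced by its decreasing rearrangement, and averaging over the
residues is the same as inserting independent uniform variables. Taking `Φ = exp (i r G)` and
applying Lévy's continuity theorem gives the convergence in law of `∑ G(ℓ / n, ℓ mod t)` for every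
summand `G` that vanishes on small sizes (`tendstoInDistribution_cycle_sum`).

A cycle of relative size `x` contributes the points `(u + q) / x`, `q ∈ ℤ`, where `t u` is a residue
of `-s ℓ`; being multiples of `1 / (t x)`, they are zero or at least `1 / (t x)` in absolute value.
If `f 0 = 0`, small cycles therefore only contribute points where `f` vanishes, both integrals of
`f` are sums of the kind just described, and the claim follows. If `f 0 > 0`, the negative part of
`f` vanishes at zero, and its integral is bounded uniformly in the permutation because there are at
most `1 / ε` cycles of relative size above `ε`; but every cycle of length divisible by `t` puts mass
at zero, and the number of such cycles tends to infinity in probability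
(`tendsto_measure_divisibleCount_le`). In the limit infinitely many `U_i` are equal to `1` by
Borel–Cantelli, so the limit is almost surely `+∞` and the integrals of `f` diverge to it. The case
`f 0 < 0` follows by negation.
-/

/-! ### Cycle counts and the exponential formula -/

/-- The product of the factorials of the multiplicities of a multiset. -/
def multiplicityFactorial (m : Multiset ℕ) : ℕ := ∏ j ∈ m.toFinset, (m.count j).factorial

theorem multiplicityFactorial_eq_prod {m : Multiset ℕ} {S : Finset ℕ} (h : m.toFinset ⊆ S) :
    multiplicityFactorial m = ∏ j ∈ S, (m.count j).factorial := by
  refine Finset.prod_subset h fun j _ hj => ?_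
  rw [Multiset.mem_toFinset] at hj
  simp [Multiset.count_eq_zero_of_notMem hj]

theorem multiplicityFactorial_pos (m : Multiset ℕ) : 0 < multiplicityFactorial m :=
  Finset.prod_pos fun _ _ => Nat.factorial_pos _

theorem multiplicityFactorial_cons (j : ℕ) (m : Multiset ℕ) :
    multiplicityFactorial (j ::ₘ m) = (m.count j + 1) * multiplicityFactorial m := by
  classical
  have h1 : (j ::ₘ m).toFinset ⊆ insert j m.toFinset := by simp
  have h2 : m.toFinset ⊆ insert j m.toFinset := Finset.subset_insert _ _
  rw [multiplicityFactorial_eq_prod h1, multiplicityFactorial_eq_prod h2,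
    ← Finset.mul_prod_erase _ _ (Finset.mem_insert_self j _),
    ← Finset.mul_prod_erase _ (fun i => (m.count i).factorial) (Finset.mem_insert_self j _),
    Multiset.count_cons_self, Nat.factorial_succ, mul_assoc]
  congr 2
  refine Finset.prod_congr rfl fun i hi => ?_
  rw [Multiset.count_cons_of_ne (Finset.ne_of_mem_erase hi)]

theorem multiplicityFactorial_add_replicate {m : Multiset ℕ} (hm : 1 ∉ m) (k : ℕ) :
    multiplicityFactorial (m + Multiset.replicate k 1) = k.factorial * multiplicityFactorial m := by
  induction k with
  | zero => simp
  | succ k ih =>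
    rw [Multiset.replicate_succ, Multiset.add_cons, multiplicityFactorial_cons, ih,
      Nat.factorial_succ]
    simp [Multiset.count_eq_zero_of_notMem hm, mul_assoc]

/-- The number of permutations of cycle type `m`, a multiset of positive integers of sum `n`. -/
theorem card_perm_parts_mul {n : ℕ} {m : Multiset ℕ} (hpos : ∀ i ∈ m, 0 < i) (hsum : m.sum = n) :
    (Finset.univ.filter fun σ : Equiv.Perm (Fin n) => σ.partition.parts = m).card *
      (m.prod * multiplicityFactorial m) = n.factorial := by
  classical
  set c := m.filter (fun i => 2 ≤ i) with hc
  have hdec : m = c + Multiset.replicate (n - c.sum) 1 := by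
    have h1 : m.filter (fun i => ¬ 2 ≤ i)
        = Multiset.replicate (m.filter (fun i => ¬ 2 ≤ i)).card 1 := by
      rw [Multiset.eq_replicate_card]
      intro b hb
      rw [Multiset.mem_filter] at hb
      have := hpos b hb.1
      omega
    have h2 : c + m.filter (fun i => ¬ 2 ≤ i) = m := Multiset.filter_add_not _ _
    have h3 : c.sum + (m.filter (fun i => ¬ 2 ≤ i)).card = n := by
      rw [← hsum]
      conv_rhs => rw [← h2, h1]
      simp
    have h4 : n - c.sum = (m.filter (fun i => ¬ 2 ≤ i)).card := by omega
    rw [h4, ← h1, h2]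
  have hcsum : c.sum ≤ n := by
    have := congrArg Multiset.sum hdec
    simp only [Multiset.sum_add, hsum] at this
    omega
  have hset : (Finset.univ.filter fun σ : Equiv.Perm (Fin n) => σ.partition.parts = m)
      = Finset.univ.filter fun σ : Equiv.Perm (Fin n) => σ.cycleType = c := by
    ext σ
    simp only [Finset.mem_filter, Finset.mem_univ, true_and]
    constructor
    · intro h
      rw [← Equiv.Perm.filter_parts_partition_eq_cycleType, h]
    · intro h
      rw [Equiv.Perm.parts_partition, ← Equiv.Perm.sum_cycleType, h, Fintype.card_fin, ← hdec]
  have h1c : 1 ∉ c := by simp [hc]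
  have key := Equiv.Perm.card_of_cycleType_mul_eq (Fin n) c
  rw [if_pos ⟨by simpa using hcsum, fun a ha => (Multiset.mem_filter.1 ha).2⟩] at key
  rw [Fintype.card_fin] at key
  rw [hset, ← key]
  conv_lhs => rw [hdec]
  rw [multiplicityFactorial_add_replicate h1c, multiplicityFactorial,
    Multiset.prod_add, Multiset.prod_replicate, one_pow, mul_one]
  ring

/-- The weight `∏ᵢ a(mᵢ) / (∏ᵢ mᵢ ∏ⱼ (count j)!)` of a multiset of cycle lengths, so that
`n!` times the weight is the contribution of the permutations of that cycle type to
`∑ σ, ∏_{c cycle of σ} a(|c|)`. -/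
noncomputable def cycleTypeWeight (a : ℕ → ℂ) (m : Multiset ℕ) : ℂ :=
  (m.map a).prod / ((m.prod : ℂ) * multiplicityFactorial m)

theorem count_mul_cycleTypeWeight_cons (a : ℕ → ℂ) {j : ℕ} (hj : j ≠ 0) (m : Multiset ℕ) :
    ((j : ℂ) * (j ::ₘ m).count j) * cycleTypeWeight a (j ::ₘ m) = a j * cycleTypeWeight a m := by
  have h1 : ((m.count j : ℂ) + 1) ≠ 0 := by exact_mod_cast (m.count j).succ_ne_zero
  have h2 : (j : ℂ) ≠ 0 := by exact_mod_cast hj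
  rw [cycleTypeWeight, cycleTypeWeight, multiplicityFactorial_cons]
  simp only [Multiset.map_cons, Multiset.prod_cons, Multiset.count_cons_self]
  rw [Nat.cast_mul, Nat.cast_mul, Nat.cast_succ, ← mul_div_assoc, ← mul_div_assoc,
    show (j : ℂ) * m.prod * (((m.count j : ℂ) + 1) * multiplicityFactorial m)
      = (j * ((m.count j : ℂ) + 1)) * ((m.prod : ℂ) * multiplicityFactorial m) by ring,
    mul_div_mul_left _ _ (mul_ne_zero h2 h1)]

/-- The multisets of positive integers of sum `n`. -/
def partitionMultisets (n : ℕ) : Finset (Multiset ℕ) :=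
  (Finset.univ : Finset n.Partition).image Nat.Partition.parts

theorem mem_partitionMultisets {n : ℕ} {m : Multiset ℕ} :
    m ∈ partitionMultisets n ↔ (∀ i ∈ m, 0 < i) ∧ m.sum = n := by
  simp only [partitionMultisets, Finset.mem_image, Finset.mem_univ, true_and]
  constructor
  · rintro ⟨p, rfl⟩
    exact ⟨fun i hi => p.parts_pos hi, p.parts_sum⟩
  · rintro ⟨h1, h2⟩
    exact ⟨⟨m, fun {i} hi => h1 i hi, h2⟩, rfl⟩

theorem parts_partition_mem {n : ℕ} (σ : Equiv.Perm (Fin n)) :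
    σ.partition.parts ∈ partitionMultisets n :=
  mem_partitionMultisets.2 ⟨fun _ hi => σ.partition.parts_pos hi,
    by rw [σ.partition.parts_sum, Fintype.card_fin]⟩

/-- The normalised cycle index `(1 / n!) ∑ σ, ∏_{c cycle of σ} a(|c|)`. -/
noncomputable def cycleIndex (a : ℕ → ℂ) (n : ℕ) : ℂ :=
  ∑ m ∈ partitionMultisets n, cycleTypeWeight a m

theorem sum_perm_prod_parts (a : ℕ → ℂ) (n : ℕ) :
    ∑ σ : Equiv.Perm (Fin n), (σ.partition.parts.map a).prod = n.factorial * cycleIndex a n := by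
  classical
  rw [← Finset.sum_fiberwise_of_maps_to (fun σ _ => parts_partition_mem σ), cycleIndex,
    Finset.mul_sum]
  refine Finset.sum_congr rfl fun m hm => ?_
  rw [Finset.sum_congr rfl (g := fun _ => (m.map a).prod)
    (fun σ hσ => by rw [(Finset.mem_filter.1 hσ).2]), Finset.sum_const, nsmul_eq_mul]
  obtain ⟨hpos, hsum⟩ := mem_partitionMultisets.1 hm
  rw [← card_perm_parts_mul hpos hsum, cycleTypeWeight]
  have h1 : (multiplicityFactorial m : ℂ) ≠ 0 := by
    exact_mod_cast (multiplicityFactorial_pos m).ne'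
  have h2 : (m.prod : ℂ) ≠ 0 := by
    exact_mod_cast (Multiset.prod_pos hpos).ne'
  rw [Nat.cast_mul, Nat.cast_mul]
  field_simp

/-- Newton's recursion for the cycle index: mark a point and remove the cycle that contains it. -/
theorem mul_cycleIndex (a : ℕ → ℂ) (n : ℕ) :
    n * cycleIndex a n = ∑ j ∈ Finset.Icc 1 n, a j * cycleIndex a (n - j) := by
  classical
  have h1 : ∀ m ∈ partitionMultisets n, (n : ℂ) * cycleTypeWeight a m
      = ∑ j ∈ Finset.Icc 1 n, ((j : ℂ) * m.count j) * cycleTypeWeight a m := by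
    intro m hm
    obtain ⟨hpos, hsum⟩ := mem_partitionMultisets.1 hm
    rw [← Finset.sum_mul]
    congr 1
    have hsub : m.toFinset ⊆ Finset.Icc 1 n := fun j hj => by
      rw [Multiset.mem_toFinset] at hj
      exact Finset.mem_Icc.2 ⟨hpos j hj, hsum ▸ Multiset.le_sum_of_mem hj⟩
    conv_lhs => rw [← hsum, ← Multiset.map_id m, Finset.sum_multiset_map_count]
    rw [Finset.sum_subset hsub]
    · push_cast
      refine Finset.sum_congr rfl fun j _ => ?_
      simp [mul_comm]
    · intro j _ hj
      rw [Multiset.mem_toFinset] at hj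
      simp [Multiset.count_eq_zero_of_notMem hj]
  rw [cycleIndex, Finset.mul_sum, Finset.sum_congr rfl h1, Finset.sum_comm]
  refine Finset.sum_congr rfl fun j hj => ?_
  obtain ⟨hj1, hjn⟩ := Finset.mem_Icc.1 hj
  rw [cycleIndex, Finset.mul_sum]
  rw [← Finset.sum_filter_of_ne (p := fun m => j ∈ m)]
  · symm
    refine Finset.sum_nbij' (fun m => j ::ₘ m) (fun m => m.erase j) ?_ ?_ ?_ ?_ ?_
    · intro m hm
      obtain ⟨hpos, hsum⟩ := mem_partitionMultisets.1 hm
      refine Finset.mem_filter.2 ⟨mem_partitionMultisets.2 ⟨?_, ?_⟩, Multiset.mem_cons_self _ _⟩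
      · intro i hi
        rcases Multiset.mem_cons.1 hi with rfl | hi
        · exact hj1
        · exact hpos i hi
      · rw [Multiset.sum_cons, hsum]; omega
    · intro m hm
      obtain ⟨hm, hjm⟩ := Finset.mem_filter.1 hm
      obtain ⟨hpos, hsum⟩ := mem_partitionMultisets.1 hm
      refine mem_partitionMultisets.2 ⟨fun i hi => hpos i (Multiset.mem_of_mem_erase hi), ?_⟩
      have := Multiset.sum_erase hjm
      omega
    · intro m _
      simp
    · intro m hm
      exact Multiset.cons_erase (Finset.mem_filter.1 hm).2
    · intro m _
      exact (count_mul_cycleTypeWeight_cons a (by omega) m).symm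
  · intro m _ hne
    by_contra hjm
    exact hne (by simp [Multiset.count_eq_zero_of_notMem hjm])

theorem cycleIndex_zero (a : ℕ → ℂ) : cycleIndex a 0 = 1 := by
  have h := sum_perm_prod_parts a 0
  have h0 : (1 : Equiv.Perm (Fin 0)).partition.parts = 0 := by
    have := mem_partitionMultisets.1 (parts_partition_mem (1 : Equiv.Perm (Fin 0)))
    by_contra hne
    obtain ⟨x, hx⟩ := Multiset.exists_mem_of_ne_zero hne
    have h1 := this.1 x hx
    have h2 := Multiset.le_sum_of_mem hx
    omega
  rw [Fintype.sum_unique, show (default : Equiv.Perm (Fin 0)) = 1 from Subsingleton.elim _ _,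
    h0] at h
  simpa using h.symm

/-! ### The Ewens expectation of a multiplicative functional -/

/-- The coefficient `θ (θ + 1) ⋯ (θ + k - 1) / k!` of `z ^ k` in `(1 - z) ^ (-θ)`. -/
noncomputable def risingCoeff (θ : ℝ) (k : ℕ) : ℝ :=
  (∏ i ∈ Finset.range k, (θ + i)) / k.factorial

/-- The law of the length `ℓ ∈ {1, …, m}` of the cycle of an Ewens permutation of `m` points that
contains a given point. -/
noncomputable def cycleKernel (θ : ℝ) (m ℓ : ℕ) : ℝ :=
  θ / m * risingCoeff θ (m - ℓ) / risingCoeff θ m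

/-- The expectation under the Ewens distribution of `∏_{c cycle of σ} F(|c|)`. -/
noncomputable def ewensProduct (θ : ℝ) (F : ℕ → ℂ) (n : ℕ) : ℂ :=
  cycleIndex (fun ℓ => θ * F ℓ) n / risingCoeff θ n

theorem prod_range_add_pos {θ : ℝ} (hθ : 0 < θ) (n : ℕ) : 0 < ∏ i ∈ Finset.range n, (θ + i) :=
  Finset.prod_pos fun i _ => by positivity

theorem risingCoeff_pos {θ : ℝ} (hθ : 0 < θ) (n : ℕ) : 0 < risingCoeff θ n :=
  div_pos (prod_range_add_pos hθ n) (by exact_mod_cast n.factorial_pos)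

theorem ewensProduct_zero (θ : ℝ) (F : ℕ → ℂ) : ewensProduct θ F 0 = 1 := by
  simp [ewensProduct, cycleIndex_zero, risingCoeff]

theorem ewensProduct_eq_sum {θ : ℝ} (hθ : 0 < θ) (F : ℕ → ℂ) {m : ℕ} (hm : 0 < m) :
    ewensProduct θ F m
      = ∑ ℓ ∈ Finset.Icc 1 m, (cycleKernel θ m ℓ : ℂ) * F ℓ * ewensProduct θ F (m - ℓ) := by
  have h := mul_cycleIndex (fun ℓ => θ * F ℓ) m
  have hm0 : (m : ℂ) ≠ 0 := by exact_mod_cast hm.ne'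
  have h' : cycleIndex (fun ℓ => θ * F ℓ) m
      = ∑ j ∈ Finset.Icc 1 m, θ / m * F j * cycleIndex (fun ℓ => θ * F ℓ) (m - j) := by
    rw [← mul_right_inj' hm0, h, Finset.mul_sum]
    refine Finset.sum_congr rfl fun j _ => ?_
    field_simp
  have hw : ∀ k : ℕ, (risingCoeff θ k : ℂ) ≠ 0 := fun k => by
    exact_mod_cast (risingCoeff_pos hθ k).ne'
  rw [ewensProduct, h', Finset.sum_div]
  refine Finset.sum_congr rfl fun j _ => ?_
  rw [cycleKernel, ewensProduct]
  have h1 := hw m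
  have h2 := hw (m - j)
  push_cast
  field_simp

theorem integral_ewens {θ : ℝ} (hθ : 0 < θ) {n : ℕ} (g : Equiv.Perm (Fin n) → ℂ) :
    ∫ σ, g σ ∂(ewens θ hθ n).toMeasure
      = ∑ σ, ((θ ^ numCycles σ / ∏ i ∈ Finset.range n, (θ + i) : ℝ) : ℂ) * g σ := by
  rw [PMF.integral_eq_sum]
  refine Finset.sum_congr rfl fun σ _ => ?_
  have : (0 : ℝ) ≤ θ ^ numCycles σ / ∏ i ∈ Finset.range n, (θ + i) :=
    div_nonneg (by positivity) (prod_range_add_pos hθ n).le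
  rw [ewens, PMF.ofFintype_apply, ENNReal.toReal_ofReal this, Complex.real_smul]

theorem integral_ewens_prod {θ : ℝ} (hθ : 0 < θ) (F : ℕ → ℂ) (n : ℕ) :
    ∫ σ, (σ.partition.parts.map F).prod ∂(ewens θ hθ n).toMeasure = ewensProduct θ F n := by
  rw [integral_ewens, ewensProduct]
  have h := sum_perm_prod_parts (fun ℓ => θ * F ℓ) n
  have hn : (n.factorial : ℂ) ≠ 0 := by exact_mod_cast n.factorial_ne_zero
  have hw : ((∏ i ∈ Finset.range n, (θ + i) : ℝ) : ℂ) ≠ 0 := by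
    exact_mod_cast (prod_range_add_pos hθ n).ne'
  have e : cycleIndex (fun ℓ => θ * F ℓ) n
      = (∑ σ : Equiv.Perm (Fin n), (σ.partition.parts.map fun ℓ => θ * F ℓ).prod)
        / n.factorial := by
    rw [h]; field_simp
  rw [e, risingCoeff, Complex.ofReal_div, Complex.ofReal_natCast, div_div_div_cancel_right₀ hn,
    Finset.sum_div]
  refine Finset.sum_congr rfl fun σ _ => ?_
  rw [Multiset.prod_map_mul, Multiset.map_const', Multiset.prod_replicate, numCycles]
  rw [Complex.ofReal_div, Complex.ofReal_pow]
  ring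

/-- The kernel `cycleKernel θ m` is a probability on `{1, …, m}`. -/
theorem sum_cycleKernel {θ : ℝ} (hθ : 0 < θ) {m : ℕ} (hm : 0 < m) :
    ∑ ℓ ∈ Finset.Icc 1 m, cycleKernel θ m ℓ = 1 := by
  have h1 : ∀ n, ewensProduct θ (fun _ => 1) n = 1 := fun n => by
    rw [← integral_ewens_prod hθ]
    simp
  have := ewensProduct_eq_sum hθ (fun _ => 1) hm
  simp only [h1, mul_one] at this
  exact_mod_cast this.symm

theorem cycleKernel_nonneg {θ : ℝ} (hθ : 0 < θ) (m ℓ : ℕ) : 0 ≤ cycleKernel θ m ℓ := by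
  have h1 := risingCoeff_pos hθ m
  have h2 := risingCoeff_pos hθ (m - ℓ)
  unfold cycleKernel
  positivity

/-! ### The kernel as a beta mixture of binomial distributions -/

theorem isProbabilityMeasure_beta_one {θ : ℝ} (hθ : 0 < θ) :
    IsProbabilityMeasure (betaMeasure 1 θ) := isProbabilityMeasureBeta one_pos hθ

theorem betaPDFReal_nonneg {α β : ℝ} (hα : 0 < α) (hβ : 0 < β) (x : ℝ) :
    0 ≤ betaPDFReal α β x := by
  by_cases h : 0 < x ∧ x < 1
  · exact (betaPDFReal_pos h.1 h.2 hα hβ).le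
  · rw [betaPDFReal, if_neg h]

theorem integral_betaPDFReal {α β : ℝ} (hα : 0 < α) (hβ : 0 < β) :
    ∫ x, betaPDFReal α β x = 1 := by
  rw [integral_eq_lintegral_of_nonneg_ae (ae_of_all _ (betaPDFReal_nonneg hα hβ))
    (measurable_betaPDFReal α β).aestronglyMeasurable]
  have := lintegral_betaPDF_eq_one hα hβ
  simp only [betaPDF] at this
  rw [this, ENNReal.toReal_one]

theorem integral_betaMeasure {α β : ℝ} (hα : 0 < α) (hβ : 0 < β) (f : ℝ → ℝ) :
    ∫ x, f x ∂(betaMeasure α β) = ∫ x, betaPDFReal α β x * f x := by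
  have h : betaMeasure α β
      = volume.withDensity (fun x => ((betaPDFReal α β x).toNNReal : ℝ≥0∞)) := rfl
  rw [h, integral_withDensity_eq_integral_smul (measurable_betaPDFReal α β).real_toNNReal]
  refine integral_congr_ae (ae_of_all _ fun x => ?_)
  simp [NNReal.smul_def, Real.coe_toNNReal _ (betaPDFReal_nonneg hα hβ x)]

theorem ae_betaMeasure_mem_Ioo (α β : ℝ) : ∀ᵐ x ∂(betaMeasure α β), x ∈ Set.Ioo (0 : ℝ) 1 := by
  have hm : Measurable (betaPDF α β) := (measurable_betaPDFReal α β).ennreal_ofReal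
  rw [betaMeasure, ae_withDensity_iff hm]
  refine ae_of_all _ fun x hx => ?_
  by_contra h
  exact hx (by rw [betaPDF, betaPDFReal, if_neg (show ¬ (0 < x ∧ x < 1) from h),
    ENNReal.ofReal_zero])

theorem Gamma_add_natCast {θ : ℝ} (hθ : 0 < θ) (n : ℕ) :
    Real.Gamma (θ + n) = (∏ i ∈ Finset.range n, (θ + i)) * Real.Gamma θ := by
  induction n with
  | zero => simp
  | succ n ih =>
    rw [Nat.cast_succ, ← add_assoc, Real.Gamma_add_one (by positivity), ih,
      Finset.prod_range_succ]
    ring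

/-- The probability that a binomial variable with parameters `n` and `w` equals `k`. -/
noncomputable def binomialWeight (n k : ℕ) (w : ℝ) : ℝ :=
  (n.choose k : ℝ) * w ^ k * (1 - w) ^ (n - k)

@[fun_prop]
theorem continuous_binomialWeight (n k : ℕ) : Continuous (binomialWeight n k) := by
  unfold binomialWeight; fun_prop

theorem integral_pow_mul_pow {θ : ℝ} (hθ : 0 < θ) (k j : ℕ) :
    ∫ w, w ^ k * (1 - w) ^ j ∂(betaMeasure 1 θ) = beta (1 + k) (θ + j) / beta 1 θ := by
  have hb := beta_pos (α := 1) one_pos hθ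
  have hk : (0 : ℝ) < 1 + k := by positivity
  have hj : (0 : ℝ) < θ + j := by positivity
  have hb' := beta_pos hk hj
  have e := integral_const_mul (μ := volume) (beta (1 + k) (θ + j) / beta 1 θ)
    (betaPDFReal (1 + k) (θ + j))
  rw [integral_betaPDFReal hk hj, mul_one] at e
  rw [integral_betaMeasure one_pos hθ, ← e]
  refine integral_congr_ae (ae_of_all _ fun w => ?_)
  by_cases h : 0 < w ∧ w < 1
  · simp only [betaPDFReal, if_pos h]
    have h1 : (0 : ℝ) < 1 - w := by linarith [h.2]
    rw [show (1 : ℝ) + k - 1 = (1 - 1) + k by ring, show θ + (j : ℝ) - 1 = θ - 1 + j by ring,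
      Real.rpow_add h.1, Real.rpow_add h1, Real.rpow_natCast, Real.rpow_natCast]
    field_simp
  · simp [betaPDFReal, if_neg h]

/-- The length of the cycle containing a given point, minus one, is a binomial variable whose
parameter is beta distributed. -/
theorem integral_binomialWeight {θ : ℝ} (hθ : 0 < θ) {n k : ℕ} (hk : k ≤ n) :
    ∫ w, binomialWeight n k w ∂(betaMeasure 1 θ) = cycleKernel θ (n + 1) (k + 1) := by
  simp only [binomialWeight, mul_assoc]
  rw [integral_const_mul, integral_pow_mul_pow hθ, beta, beta]
  have hG := Real.Gamma_pos_of_pos hθ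
  have e1 : (1 : ℝ) + k + (θ + (n - k : ℕ)) = θ + (n + 1 : ℕ) := by
    push_cast [Nat.cast_sub hk]; ring
  rw [e1, Gamma_add_natCast hθ, Gamma_add_natCast hθ, add_comm 1 (k : ℝ),
    Real.Gamma_nat_eq_factorial, Real.Gamma_one, add_comm 1 θ, Real.Gamma_add_one hθ.ne',
    cycleKernel, risingCoeff, risingCoeff, Nat.add_sub_add_right, Nat.factorial_succ]
  have h1 := (prod_range_add_pos hθ (n + 1)).ne'
  have h3 : ((n - k).factorial : ℝ) ≠ 0 := by exact_mod_cast (n - k).factorial_ne_zero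
  have h4 : ((n + 1 : ℕ) : ℝ) ≠ 0 := by exact_mod_cast n.succ_ne_zero
  have h5 : (n.choose k : ℝ) * k.factorial * (n - k).factorial = n.factorial := by
    exact_mod_cast Nat.choose_mul_factorial_mul_factorial hk
  have h6 := hG.ne'
  have h7 := hθ.ne'
  rw [Nat.cast_mul, ← h5]
  field_simp

theorem integrable_of_continuous_beta {θ : ℝ} (hθ : 0 < θ) {E : Type*} [NormedAddCommGroup E]
    {g : ℝ → E} (hg : Continuous g) : Integrable g (betaMeasure 1 θ) := by
  have := isProbabilityMeasure_beta_one hθ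
  obtain ⟨C, hC⟩ := isCompact_Icc.exists_bound_of_continuousOn (hg.continuousOn (s := Set.Icc 0 1))
  refine Integrable.of_bound hg.aestronglyMeasurable C ?_
  filter_upwards [ae_betaMeasure_mem_Ioo 1 θ] with w hw
  exact hC w ⟨hw.1.le, hw.2.le⟩

theorem sum_binomialWeight (n : ℕ) (w : ℝ) :
    ∑ k ∈ Finset.range (n + 1), binomialWeight n k w = 1 := by
  have h := add_pow w (1 - w) n
  rw [add_sub_cancel, one_pow] at h
  rw [h]
  refine Finset.sum_congr rfl fun k _ => ?_
  rw [binomialWeight]; ring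

theorem sum_mul_binomialWeight (n : ℕ) (w : ℝ) :
    ∑ k ∈ Finset.range (n + 1), (k : ℝ) * binomialWeight n k w = n * w := by
  have := congrArg (Polynomial.eval w) (bernsteinPolynomial.sum_smul ℝ n)
  rw [Polynomial.eval_finsetSum] at this
  simpa [bernsteinPolynomial, binomialWeight] using this

theorem sum_Icc_one_eq_sum_range {M : Type*} [AddCommMonoid M] (f : ℕ → M) (n : ℕ) :
    ∑ ℓ ∈ Finset.Icc 1 (n + 1), f ℓ = ∑ k ∈ Finset.range (n + 1), f (k + 1) := by
  rw [Finset.range_eq_Ico, Finset.sum_Ico_add' f 0 (n + 1) 1]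
  rfl

theorem integral_one_sub_beta {θ : ℝ} (hθ : 0 < θ) :
    ∫ w, (1 - w) ∂(betaMeasure 1 θ) = θ / (1 + θ) := by
  have h := integral_binomialWeight hθ (Nat.zero_le 1)
  simp only [binomialWeight, cycleKernel, risingCoeff] at h
  simp [Finset.prod_range_succ] at h
  rw [h]
  field_simp
  ring

/-- On average a cycle takes a fixed proportion of the points. -/
theorem sum_cycleKernel_mul_sub_le {θ : ℝ} (hθ : 0 < θ) {m : ℕ} (hm : 0 < m) :
    ∑ ℓ ∈ Finset.Icc 1 m, cycleKernel θ m ℓ * ((m - ℓ : ℕ) : ℝ) ≤ m * (θ / (1 + θ)) := by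
  obtain ⟨n, rfl⟩ : ∃ n, m = n + 1 := ⟨m - 1, by omega⟩
  rw [sum_Icc_one_eq_sum_range]
  have h1 : ∀ k ∈ Finset.range (n + 1), cycleKernel θ (n + 1) (k + 1) * ((n + 1 - (k + 1) : ℕ) : ℝ)
      = ∫ w, binomialWeight n k w * ((n : ℝ) - k) ∂(betaMeasure 1 θ) := by
    intro k hk
    have hk' : k ≤ n := by simpa [Nat.lt_succ_iff] using hk
    rw [integral_mul_const, integral_binomialWeight hθ hk', Nat.add_sub_add_right,
      Nat.cast_sub hk']
  rw [Finset.sum_congr rfl h1, ← integral_finsetSum _ fun k _ =>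
    integrable_of_continuous_beta hθ (by fun_prop)]
  have h2 : ∀ w : ℝ, ∑ k ∈ Finset.range (n + 1), binomialWeight n k w * ((n : ℝ) - k)
      = n * (1 - w) := by
    intro w
    have e : ∀ k : ℕ, binomialWeight n k w * ((n : ℝ) - k)
        = n * binomialWeight n k w - k * binomialWeight n k w := fun k => by ring
    simp only [e]
    rw [Finset.sum_sub_distrib, ← Finset.mul_sum, sum_binomialWeight, sum_mul_binomialWeight]
    ring
  simp only [h2]
  rw [integral_const_mul, integral_one_sub_beta hθ]
  refine mul_le_mul_of_nonneg_right ?_ (by positivity)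
  push_cast; linarith

theorem tendsto_integral_pow_beta {θ : ℝ} (hθ : 0 < θ) :
    Tendsto (fun n : ℕ => ∫ w, w ^ n ∂(betaMeasure 1 θ)) atTop (nhds 0) := by
  have := isProbabilityMeasure_beta_one hθ
  have h := tendsto_integral_of_dominated_convergence (μ := betaMeasure 1 θ)
    (F := fun (n : ℕ) (w : ℝ) => w ^ n) (f := fun _ => 0) (fun _ => 1)
    (fun n => (continuous_pow n).aestronglyMeasurable) (integrable_const _) ?_ ?_
  · simpa using h
  · intro n
    filter_upwards [ae_betaMeasure_mem_Ioo 1 θ] with w hw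
    rw [norm_pow, Real.norm_of_nonneg hw.1.le]
    exact pow_le_one₀ hw.1.le hw.2.le
  · filter_upwards [ae_betaMeasure_mem_Ioo 1 θ] with w hw
    exact tendsto_pow_atTop_nhds_zero_of_lt_one hw.1.le hw.2

theorem tendsto_integral_one_sub_pow_beta {θ : ℝ} (hθ : 0 < θ) :
    Tendsto (fun n : ℕ => ∫ w, (1 - w) ^ n ∂(betaMeasure 1 θ)) atTop (nhds 0) := by
  have := isProbabilityMeasure_beta_one hθ
  have h := tendsto_integral_of_dominated_convergence (μ := betaMeasure 1 θ)
    (F := fun (n : ℕ) (w : ℝ) => (1 - w) ^ n) (f := fun _ => 0) (fun _ => 1)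
    (fun n => (by fun_prop : Continuous fun w : ℝ => (1 - w) ^ n).aestronglyMeasurable)
    (integrable_const _) ?_ ?_
  · simpa using h
  · intro n
    filter_upwards [ae_betaMeasure_mem_Ioo 1 θ] with w hw
    rw [norm_pow, Real.norm_of_nonneg (by linarith [hw.2])]
    exact pow_le_one₀ (by linarith [hw.2]) (by linarith [hw.1])
  · filter_upwards [ae_betaMeasure_mem_Ioo 1 θ] with w hw
    exact tendsto_pow_atTop_nhds_zero_of_lt_one (by linarith [hw.2]) (by linarith [hw.1])

theorem tendsto_cycleKernel_endpoints {θ : ℝ} (hθ : 0 < θ) :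
    Tendsto (fun m => cycleKernel θ m 1 + cycleKernel θ m m) atTop (nhds 0) := by
  rw [← tendsto_add_atTop_iff_nat 1]
  have h := (tendsto_integral_one_sub_pow_beta hθ).add (tendsto_integral_pow_beta hθ)
  rw [add_zero] at h
  refine h.congr fun n => ?_
  have h1 := integral_binomialWeight hθ (Nat.zero_le n)
  have h2 := integral_binomialWeight hθ (le_refl n)
  rw [zero_add] at h1
  rw [← h1, ← h2]
  simp [binomialWeight]

theorem risingCoeff_succ (θ : ℝ) (k : ℕ) :
    risingCoeff θ (k + 1) = risingCoeff θ k * ((θ + k) / (k + 1)) := by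
  rw [risingCoeff, risingCoeff, Finset.prod_range_succ, Nat.factorial_succ]
  push_cast
  rw [mul_comm ((k : ℝ) + 1), mul_div_mul_comm]

/-- The kernel is monotone in the cycle length, so its total variation is controlled by its
values at the two ends. -/
theorem sum_abs_cycleKernel_sub_le {θ : ℝ} (hθ : 0 < θ) (n : ℕ) :
    ∑ k ∈ Finset.range n, |cycleKernel θ (n + 1) (k + 1) - cycleKernel θ (n + 1) (k + 2)|
      ≤ cycleKernel θ (n + 1) 1 + cycleKernel θ (n + 1) (n + 1) := by
  have hn1 := cycleKernel_nonneg hθ (n + 1) 1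
  have hn2 := cycleKernel_nonneg hθ (n + 1) (n + 1)
  have hstep : ∀ k ∈ Finset.range n, cycleKernel θ (n + 1) (k + 1)
      = cycleKernel θ (n + 1) (k + 2) * ((θ + (n - 1 - k : ℕ)) / ((n - 1 - k : ℕ) + 1)) := by
    intro k hk
    have hk := Finset.mem_range.1 hk
    rw [cycleKernel, cycleKernel, show n + 1 - (k + 1) = (n - 1 - k) + 1 by omega,
      show n + 1 - (k + 2) = n - 1 - k by omega, risingCoeff_succ]
    ring
  have hnn := fun k => cycleKernel_nonneg hθ (n + 1) k
  have htel : ∑ k ∈ Finset.range n, (cycleKernel θ (n + 1) (k + 1) - cycleKernel θ (n + 1) (k + 2))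
      = cycleKernel θ (n + 1) 1 - cycleKernel θ (n + 1) (n + 1) :=
    Finset.sum_range_sub' (fun k => cycleKernel θ (n + 1) (k + 1)) n
  rcases le_total 1 θ with h1 | h1
  · rw [Finset.sum_congr rfl fun k hk => abs_of_nonneg (sub_nonneg.2 ?_)]
    · rw [htel]; linarith
    · rw [hstep k hk]
      exact le_mul_of_one_le_right (hnn _) ((one_le_div (by positivity)).2 (by linarith))
  · rw [Finset.sum_congr rfl fun k hk => abs_of_nonpos (sub_nonpos.2 ?_)]
    · rw [Finset.sum_neg_distrib, htel]; linarith
    · rw [hstep k hk]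
      exact mul_le_of_le_one_right (hnn _) ((div_le_one (by positivity)).2 (by linarith))

/-! ### Convergence of the kernel to the beta distribution, uniformly over residue classes -/

section KernelLimit

theorem uniform_modulus_of_continuous {E : Type*} [NormedAddCommGroup E] {g : ℝ → E}
    (hg : Continuous g) {η : ℝ} (hη : 0 < η) :
    ∃ δ > 0, ∀ x ∈ Set.Icc (0 : ℝ) 1, ∀ y ∈ Set.Icc (0 : ℝ) 1, |x - y| < δ → ‖g x - g y‖ < η := by
  have h := isCompact_Icc.uniformContinuousOn_of_continuous (hg.continuousOn (s := Set.Icc 0 1))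
  rw [Metric.uniformContinuousOn_iff] at h
  obtain ⟨δ, hδ, h⟩ := h η hη
  refine ⟨δ, hδ, fun x hx y hy hxy => ?_⟩
  rw [← dist_eq_norm]
  exact h x hx y hy (by rwa [Real.dist_eq])

variable {E : Type*} [NormedAddCommGroup E] [NormedSpace ℝ E]

theorem norm_sum_cycleKernel_smul_le {θ : ℝ} (hθ : 0 < θ) {m : ℕ} (hm : 0 < m) {g : ℕ → E} {η : ℝ}
    (h : ∀ ℓ ∈ Finset.Icc 1 m, ‖g ℓ‖ ≤ η) :
    ‖∑ ℓ ∈ Finset.Icc 1 m, cycleKernel θ m ℓ • g ℓ‖ ≤ η := by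
  calc ‖∑ ℓ ∈ Finset.Icc 1 m, cycleKernel θ m ℓ • g ℓ‖
      ≤ ∑ ℓ ∈ Finset.Icc 1 m, cycleKernel θ m ℓ * η := by
        refine norm_sum_le_of_le _ fun ℓ hℓ => ?_
        rw [norm_smul, Real.norm_of_nonneg (cycleKernel_nonneg hθ m ℓ)]
        exact mul_le_mul_of_nonneg_left (h ℓ hℓ) (cycleKernel_nonneg hθ m ℓ)
    _ = η := by rw [← Finset.sum_mul, sum_cycleKernel hθ hm, one_mul]

theorem eventually_inv_lt {δ : ℝ} (hδ : 0 < δ) : ∀ᶠ n : ℕ in atTop, 1 / ((n : ℝ) + 1) < δ :=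
  (tendsto_one_div_add_atTop_nhds_zero_nat (𝕜 := ℝ)).eventually_lt_const hδ

open unitInterval in
theorem tendsto_sum_cycleKernel_smul [CompleteSpace E] {θ : ℝ} (hθ : 0 < θ) {g : ℝ → E}
    (hg : Continuous g) :
    Tendsto (fun m : ℕ => ∑ ℓ ∈ Finset.Icc 1 m, cycleKernel θ m ℓ • g (ℓ / m)) atTop
      (nhds (∫ w, g w ∂(betaMeasure 1 θ))) := by
  have := isProbabilityMeasure_beta_one hθ
  rw [← tendsto_add_atTop_iff_nat 1, Metric.tendsto_nhds]
  intro η hη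
  obtain ⟨δ, hδ, hmod⟩ := uniform_modulus_of_continuous hg (half_pos (half_pos hη))
  let G : C(I, E) := ⟨fun x => g x, by fun_prop⟩
  have hB := (Metric.tendsto_nhds.1 (bernsteinApproximation_uniform G)) (η / 2) (half_pos hη)
  filter_upwards [hB, eventually_inv_lt hδ] with n hn hnδ
  have hmean : ∑ ℓ ∈ Finset.Icc 1 (n + 1), cycleKernel θ (n + 1) ℓ • g ((ℓ - 1 : ℕ) / n)
      = ∫ w, ∑ k ∈ Finset.range (n + 1), binomialWeight n k w • g (k / n) ∂(betaMeasure 1 θ) := by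
    rw [sum_Icc_one_eq_sum_range, integral_finsetSum _ fun k _ =>
      integrable_of_continuous_beta hθ (by fun_prop)]
    refine Finset.sum_congr rfl fun k hk => ?_
    have hk' : k ≤ n := by simpa [Nat.lt_succ_iff] using hk
    rw [integral_smul_const, integral_binomialWeight hθ hk', Nat.add_sub_cancel]
  have h1 : ‖∑ ℓ ∈ Finset.Icc 1 (n + 1), cycleKernel θ (n + 1) ℓ • g (ℓ / (n + 1 : ℕ))
      - ∑ ℓ ∈ Finset.Icc 1 (n + 1), cycleKernel θ (n + 1) ℓ • g ((ℓ - 1 : ℕ) / n)‖ ≤ η / 2 / 2 := by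
    rw [← Finset.sum_sub_distrib]
    simp only [← smul_sub]
    refine norm_sum_cycleKernel_smul_le hθ n.succ_pos fun ℓ hℓ => (hmod _ ?_ _ ?_ ?_).le
    · obtain ⟨h1, h2⟩ := Finset.mem_Icc.1 hℓ
      exact ⟨by positivity, div_le_one_of_le₀ (by exact_mod_cast h2) (by positivity)⟩
    · obtain ⟨h1, h2⟩ := Finset.mem_Icc.1 hℓ
      exact ⟨by positivity, div_le_one_of_le₀ (by exact_mod_cast (by omega)) (by positivity)⟩
    · obtain ⟨h1, h2⟩ := Finset.mem_Icc.1 hℓ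
      refine lt_of_le_of_lt ?_ hnδ
      obtain ⟨k, rfl⟩ : ∃ k, ℓ = k + 1 := ⟨ℓ - 1, by omega⟩
      rw [Nat.add_sub_cancel]
      have hk : (k : ℝ) ≤ n := by exact_mod_cast (by omega : k ≤ n)
      have hk0 : (0 : ℝ) ≤ k := by positivity
      rcases Nat.eq_zero_or_pos n with rfl | hn0
      · have : k = 0 := by omega
        subst this
        simp
      · have hn0' : (0 : ℝ) < n := by exact_mod_cast hn0
        have e : ((k + 1 : ℕ) : ℝ) / (n + 1 : ℕ) - k / n
            = (1 - k / n) / ((n : ℝ) + 1) := by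
          push_cast; field_simp; ring
        have h3 : (k : ℝ) / n ≤ 1 := div_le_one_of_le₀ hk hn0'.le
        have h4 : (0 : ℝ) ≤ k / n := by positivity
        rw [e, abs_of_nonneg (div_nonneg (by linarith) (by positivity))]
        exact div_le_div_of_nonneg_right (by linarith) (by positivity)
  have h2 : ‖∫ w, ∑ k ∈ Finset.range (n + 1), binomialWeight n k w • g (k / n) ∂(betaMeasure 1 θ)
      - ∫ w, g w ∂(betaMeasure 1 θ)‖ ≤ η / 2 := by
    rw [← integral_sub (integrable_of_continuous_beta hθ (by fun_prop))
      (integrable_of_continuous_beta hθ hg)]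
    refine (norm_integral_le_of_norm_le_const (C := η / 2) ?_).trans (by simp)
    filter_upwards [ae_betaMeasure_mem_Ioo 1 θ] with w hw
    have h3 := (ContinuousMap.dist_apply_le_dist (f := bernsteinApproximation n G) (g := G)
      ⟨w, hw.1.le, hw.2.le⟩).trans hn.le
    rw [bernsteinApproximation.apply, dist_eq_norm] at h3
    refine le_trans (le_of_eq ?_) h3
    congr 2
    rw [Finset.sum_range]
    refine Finset.sum_congr rfl fun k _ => ?_
    rw [bernstein_apply]
    rfl
  rw [dist_eq_norm]
  rw [hmean] at h1
  calc _ ≤ _ := norm_sub_le_norm_sub_add_norm_sub _ _ _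
    _ < η := by
      have := add_le_add h1 h2
      refine lt_of_le_of_lt this (by linarith)

theorem sum_range_add_of_periodic {M : Type*} [AddCommGroup M] {t : ℕ} {g : ℕ → M}
    (hg : Function.Periodic g t) (k : ℕ) :
    ∑ j ∈ Finset.range t, g (k + j) = ∑ j ∈ Finset.range t, g j := by
  induction k with
  | zero => simp
  | succ k ih =>
    rw [← ih]
    have h1 := Finset.sum_range_succ (fun j => g (k + j)) t
    rw [Finset.sum_range_succ', add_zero, hg k] at h1
    rw [← add_right_cancel h1]
    exact Finset.sum_congr rfl fun j _ => by rw [add_assoc, add_comm 1 j]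

/-- The kernel does not see residue classes in the limit: advancing the class of the cycle length
by one changes the mean of a continuous function by a vanishing amount. -/
theorem tendsto_sum_cycleKernel_shift {θ : ℝ} (hθ : 0 < θ) {t : ℕ} (ht : 0 < t) {g : ℕ → ℝ → E}
    (hper : Function.Periodic g t) (hg : ∀ r, Continuous (g r)) (j : ℕ) :
    Tendsto (fun m : ℕ => ∑ ℓ ∈ Finset.Icc 1 m, cycleKernel θ m ℓ • g (ℓ + j + 1) (ℓ / m)
      - ∑ ℓ ∈ Finset.Icc 1 m, cycleKernel θ m ℓ • g (ℓ + j) (ℓ / m)) atTop (nhds 0) := by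
  -- all residue classes at once, so that moduli and bounds are uniform in the class
  let G : ℝ → Fin t → E := fun x r => g r x
  have hG : Continuous G := continuous_pi fun r => hg r
  have hgG : ∀ r x, g r x = G x ⟨r % t, Nat.mod_lt _ ht⟩ := fun r x => by
    rw [← hper.map_mod_nat r]
  obtain ⟨C, hC⟩ := isCompact_Icc.exists_bound_of_continuousOn (hG.continuousOn (s := Set.Icc 0 1))
  have hC' : ∀ r, ∀ x ∈ Set.Icc (0 : ℝ) 1, ‖g r x‖ ≤ C := fun r x hx => by
    rw [hgG]; exact (norm_le_pi_norm _ _).trans (hC x hx)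
  have hC0 : 0 ≤ C := (norm_nonneg _).trans (hC' 0 0 (by simp))
  rw [← tendsto_add_atTop_iff_nat 1, Metric.tendsto_nhds]
  intro η hη
  obtain ⟨δ, hδ, hmod⟩ := uniform_modulus_of_continuous hG (half_pos hη)
  have hend :=
    ((tendsto_add_atTop_iff_nat 1).2 (tendsto_cycleKernel_endpoints hθ)).const_mul (2 * C)
  rw [mul_zero] at hend
  filter_upwards [eventually_inv_lt hδ, hend.eventually_lt_const (half_pos hη)] with n hnδ hn
  rw [dist_zero_right, sum_Icc_one_eq_sum_range, sum_Icc_one_eq_sum_range]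
  set p := fun k => cycleKernel θ (n + 1) (k + 1) with hp
  have hp0 : ∀ k, 0 ≤ p k := fun k => cycleKernel_nonneg hθ _ _
  have hmem : ∀ k ≤ n, ((k + 1 : ℕ) : ℝ) / (n + 1 : ℕ) ∈ Set.Icc (0 : ℝ) 1 := fun k hk =>
    ⟨by positivity, div_le_one_of_le₀ (by exact_mod_cast (by omega)) (by positivity)⟩
  set X := fun k : ℕ => ((k + 1 : ℕ) : ℝ) / (n + 1 : ℕ) with hX
  have hsplit : ∑ k ∈ Finset.range (n + 1), p k • g (k + 1 + j + 1) (X k)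
      - ∑ k ∈ Finset.range (n + 1), p k • g (k + 1 + j) (X k)
      = ∑ k ∈ Finset.range n, (p k • (g (k + j + 2) (X k) - g (k + j + 2) (X (k + 1)))
          + (p k - p (k + 1)) • g (k + j + 2) (X (k + 1)))
        + (p n • g (n + j + 2) (X n) - p 0 • g (j + 1) (X 0)) := by
    rw [Finset.sum_range_succ, Finset.sum_range_succ' (fun k => p k • g (k + 1 + j) (X k))]
    have e : ∀ k, p k • (g (k + j + 2) (X k) - g (k + j + 2) (X (k + 1)))
          + (p k - p (k + 1)) • g (k + j + 2) (X (k + 1))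
        = p k • g (k + 1 + j + 1) (X k) - p (k + 1) • g (k + 1 + 1 + j) (X (k + 1)) := fun k => by
      rw [show k + 1 + j + 1 = k + j + 2 by omega, show k + 1 + 1 + j = k + j + 2 by omega,
        smul_sub, sub_smul]
      abel
    rw [Finset.sum_congr rfl fun k _ => e k, Finset.sum_sub_distrib,
      show n + 1 + j + 1 = n + j + 2 by omega, show 0 + 1 + j = j + 1 by omega]
    abel
  have hbody : ‖∑ k ∈ Finset.range n, (p k • (g (k + j + 2) (X k) - g (k + j + 2) (X (k + 1)))
          + (p k - p (k + 1)) • g (k + j + 2) (X (k + 1)))‖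
      ≤ η / 2 + (p 0 + p n) * C := by
    calc _ ≤ ∑ k ∈ Finset.range n, (p k * (η / 2) + |p k - p (k + 1)| * C) := by
          refine norm_sum_le_of_le _ fun k hk => (norm_add_le _ _).trans (add_le_add ?_ ?_)
          · have hk := Finset.mem_range.1 hk
            rw [norm_smul, Real.norm_of_nonneg (hp0 k)]
            refine mul_le_mul_of_nonneg_left ?_ (hp0 k)
            rw [hgG, hgG]
            refine (norm_le_pi_norm (G (X k) - G (X (k + 1))) _).trans
              (hmod _ (hmem k (by omega)) _ (hmem (k + 1) (by omega)) (lt_of_le_of_lt ?_ hnδ)).le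
            have e : ((k + 1 : ℕ) : ℝ) / (n + 1 : ℕ) - ((k + 1 + 1 : ℕ) : ℝ) / (n + 1 : ℕ)
                = -(1 / ((n : ℝ) + 1)) := by
              push_cast; field_simp; ring
            rw [e, abs_neg, abs_of_nonneg (by positivity)]
          · have hk := Finset.mem_range.1 hk
            rw [norm_smul, Real.norm_eq_abs]
            exact mul_le_mul_of_nonneg_left (hC' _ _ (hmem (k + 1) (by omega))) (abs_nonneg _)
      _ = (∑ k ∈ Finset.range n, p k) * (η / 2)
          + (∑ k ∈ Finset.range n, |p k - p (k + 1)|) * C := by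
          rw [Finset.sum_add_distrib, Finset.sum_mul, Finset.sum_mul]
      _ ≤ _ := by
          refine add_le_add ?_ (mul_le_mul_of_nonneg_right (sum_abs_cycleKernel_sub_le hθ n) hC0)
          have h1 := sum_cycleKernel hθ n.succ_pos
          rw [Nat.succ_eq_add_one, sum_Icc_one_eq_sum_range, Finset.sum_range_succ] at h1
          have h2 : ∑ k ∈ Finset.range n, p k ≤ 1 := by
            rw [← h1]; exact le_add_of_nonneg_right (hp0 n)
          exact mul_le_of_le_one_left (half_pos hη).le h2
  have hbdry : ‖p n • g (n + j + 2) (X n) - p 0 • g (j + 1) (X 0)‖ ≤ (p 0 + p n) * C := by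
    refine (norm_sub_le _ _).trans ?_
    rw [norm_smul, norm_smul, Real.norm_of_nonneg (hp0 n), Real.norm_of_nonneg (hp0 0)]
    have h1 := mul_le_mul_of_nonneg_left (hC' (n + j + 2) _ (hmem n le_rfl)) (hp0 n)
    have h2 := mul_le_mul_of_nonneg_left (hC' (j + 1) _ (hmem 0 (Nat.zero_le _))) (hp0 0)
    exact (add_le_add h1 h2).trans (by linarith)
  change ‖∑ k ∈ Finset.range (n + 1), p k • g (k + 1 + j + 1) (X k)
      - ∑ k ∈ Finset.range (n + 1), p k • g (k + 1 + j) (X k)‖ < η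
  rw [hsplit]
  refine lt_of_le_of_lt (norm_add_le _ _) ?_
  have hn' : 2 * C * (p 0 + p n) < η / 2 := hn
  linarith

/-- The proportion of points in a cycle and the residue class of its length are asymptotically
independent, the former beta distributed and the latter uniform. -/
theorem tendsto_sum_cycleKernel_periodic [CompleteSpace E] {θ : ℝ} (hθ : 0 < θ) {t : ℕ}
    (ht : 0 < t) {g : ℕ → ℝ → E} (hper : Function.Periodic g t) (hg : ∀ r, Continuous (g r)) :
    Tendsto (fun m : ℕ => ∑ ℓ ∈ Finset.Icc 1 m, cycleKernel θ m ℓ • g ℓ (ℓ / m)) atTop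
      (nhds (∫ w, (t : ℝ)⁻¹ • ∑ r ∈ Finset.range t, g r w ∂(betaMeasure 1 θ))) := by
  set D := fun (j m : ℕ) => ∑ ℓ ∈ Finset.Icc 1 m, cycleKernel θ m ℓ • g (ℓ + j) (ℓ / m) with hD
  have h1 : ∀ j, Tendsto (fun m => D j m - D 0 m) atTop (nhds 0) := by
    intro j
    induction j with
    | zero => simp
    | succ j ih =>
      have := (tendsto_sum_cycleKernel_shift hθ ht hper hg j).add ih
      rw [add_zero] at this
      exact this.congr fun m => sub_add_sub_cancel _ _ _
  have h2 := (tendsto_finsetSum (Finset.range t) fun j _ => h1 j).const_smul (t : ℝ)⁻¹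
  have h3 := tendsto_sum_cycleKernel_smul hθ
    (g := fun w => (t : ℝ)⁻¹ • ∑ r ∈ Finset.range t, g r w) (by fun_prop)
  have h4 := h3.sub h2
  simp only [Finset.sum_const_zero, smul_zero, sub_zero] at h4
  refine h4.congr fun m => ?_
  have ht' : (t : ℝ) ≠ 0 := by exact_mod_cast ht.ne'
  have e1 : ∑ ℓ ∈ Finset.Icc 1 m, cycleKernel θ m ℓ •
      ((t : ℝ)⁻¹ • ∑ r ∈ Finset.range t, g r (ℓ / m))
      = (t : ℝ)⁻¹ • ∑ j ∈ Finset.range t, D j m := by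
    simp only [hD]
    rw [Finset.sum_comm, Finset.smul_sum]
    refine Finset.sum_congr rfl fun ℓ _ => ?_
    rw [← Finset.smul_sum, smul_comm]
    congr 2
    exact (sum_range_add_of_periodic (g := fun r => g r (ℓ / m))
      (fun r => by simp only [hper r]) ℓ).symm
  rw [e1, Finset.sum_sub_distrib, smul_sub, sub_sub_cancel, Finset.sum_const, Finset.card_range,
    ← Nat.cast_smul_eq_nsmul ℝ, smul_smul, inv_mul_cancel₀ ht', one_smul]
  rfl

end KernelLimit

/-! ### Multiplicative functionals of the cycle lengths in the limit -/

/-- Factors `F x ℓ`, for a cycle of length `ℓ` of relative size `x`, that depend continuously on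
the relative size and on the length only modulo `t`, are bounded by `1`, and ignore cycles of
relative size at most `ε`. -/
structure IsCycleFactor (t : ℕ) (ε : ℝ) (F : ℝ → ℕ → ℂ) : Prop where
  periodic : ∀ x, Function.Periodic (F x) t
  continuous : ∀ r, Continuous fun x => F x r
  norm_le : ∀ x r, ‖F x r‖ ≤ 1
  eq_one : ∀ x ≤ ε, ∀ r, F x r = 1

/-- The mean of `F x` over the residue classes modulo `t`. -/
noncomputable def residueMean (t : ℕ) (F : ℝ → ℕ → ℂ) (x : ℝ) : ℂ :=
  (t : ℝ)⁻¹ • ∑ r ∈ Finset.range t, F x r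

/-- Breaking one stick off a mass `x`: the piece `x w`, with `w` beta distributed, contributes the
factor `φ (x w)`, and the remaining mass contributes `h (x (1 - w))`. -/
noncomputable def stickOperator (θ : ℝ) (φ h : ℝ → ℂ) (x : ℝ) : ℂ :=
  ∫ w, φ (x * w) * h (x * (1 - w)) ∂(betaMeasure 1 θ)

/-- The expectation of `∏ φ` over the first `N` sticks broken off a mass `x`. -/
noncomputable def stickIterate (θ : ℝ) (φ : ℝ → ℂ) (N : ℕ) : ℝ → ℂ :=
  (stickOperator θ φ)^[N] fun _ => 1

theorem stickIterate_succ (θ : ℝ) (φ : ℝ → ℂ) (N : ℕ) :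
    stickIterate θ φ (N + 1) = stickOperator θ φ (stickIterate θ φ N) :=
  Function.iterate_succ_apply' _ _ _

section Iterates

variable {θ ε : ℝ} {φ : ℝ → ℂ}

theorem IsCycleFactor.continuous_residueMean {t : ℕ} {F : ℝ → ℕ → ℂ} (hF : IsCycleFactor t ε F) :
    Continuous (residueMean t F) := by
  have := hF.continuous
  unfold residueMean
  fun_prop

theorem IsCycleFactor.norm_residueMean_le {t : ℕ} {F : ℝ → ℕ → ℂ} (hF : IsCycleFactor t ε F)
    (x : ℝ) : ‖residueMean t F x‖ ≤ 1 := by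
  rw [residueMean, norm_smul, Real.norm_of_nonneg (by positivity)]
  have h1 : ‖∑ r ∈ Finset.range t, F x r‖ ≤ t := by
    refine (norm_sum_le_of_le _ fun r _ => hF.norm_le x r).trans (by simp)
  exact (mul_le_mul_of_nonneg_left h1 (by positivity)).trans (inv_mul_le_one)

theorem IsCycleFactor.residueMean_eq_one {t : ℕ} (ht : 0 < t) {F : ℝ → ℕ → ℂ}
    (hF : IsCycleFactor t ε F) {x : ℝ} (hx : x ≤ ε) : residueMean t F x = 1 := by
  have ht' : (t : ℂ) ≠ 0 := by exact_mod_cast ht.ne'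
  rw [residueMean, Finset.sum_congr rfl fun r _ => hF.eq_one x hx r]
  simp [ht']

theorem norm_stickOperator_le (hθ : 0 < θ) (hφ : ∀ x, ‖φ x‖ ≤ 1) {h : ℝ → ℂ}
    (hh : ∀ x, ‖h x‖ ≤ 1) (x : ℝ) : ‖stickOperator θ φ h x‖ ≤ 1 := by
  have := isProbabilityMeasure_beta_one hθ
  refine (norm_integral_le_of_norm_le_const (C := 1) (ae_of_all _ fun w => ?_)).trans (by simp)
  rw [norm_mul]
  exact mul_le_one₀ (hφ _) (norm_nonneg _) (hh _)

theorem continuous_stickOperator (hθ : 0 < θ) (hφc : Continuous φ) (hφ : ∀ x, ‖φ x‖ ≤ 1)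
    {h : ℝ → ℂ} (hhc : Continuous h) (hh : ∀ x, ‖h x‖ ≤ 1) :
    Continuous (stickOperator θ φ h) := by
  have := isProbabilityMeasure_beta_one hθ
  refine continuous_of_dominated (bound := fun _ => 1)
    (fun x => (by fun_prop : Continuous _).aestronglyMeasurable)
    (fun x => ae_of_all _ fun w => ?_) (integrable_const _) (ae_of_all _ fun w => by fun_prop)
  rw [norm_mul]
  exact mul_le_one₀ (hφ _) (norm_nonneg _) (hh _)

theorem norm_stickIterate_le (hθ : 0 < θ) (hφ : ∀ x, ‖φ x‖ ≤ 1) (N : ℕ) (x : ℝ) :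
    ‖stickIterate θ φ N x‖ ≤ 1 := by
  induction N generalizing x with
  | zero => simp [stickIterate]
  | succ N ih =>
    rw [stickIterate_succ]
    exact norm_stickOperator_le hθ hφ ih x

theorem continuous_stickIterate (hθ : 0 < θ) (hφc : Continuous φ) (hφ : ∀ x, ‖φ x‖ ≤ 1) (N : ℕ) :
    Continuous (stickIterate θ φ N) := by
  induction N with
  | zero => exact continuous_const
  | succ N ih =>
    rw [stickIterate_succ]
    exact continuous_stickOperator hθ hφc hφ ih (norm_stickIterate_le hθ hφ N)

theorem mul_le_of_mem_Ioo {x w : ℝ} (hε : 0 < ε) (hx : x ≤ ε) (hw : w ∈ Set.Ioo (0 : ℝ) 1) :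
    x * w ≤ ε := by
  rcases le_total 0 x with h | h
  · exact (mul_le_of_le_one_right h hw.2.le).trans hx
  · exact (mul_nonpos_of_nonpos_of_nonneg h hw.1.le).trans hε.le

theorem stickIterate_eq_one (hθ : 0 < θ) (hε : 0 < ε) (hφ1 : ∀ x ≤ ε, φ x = 1) (N : ℕ) {x : ℝ}
    (hx : x ≤ ε) : stickIterate θ φ N x = 1 := by
  have := isProbabilityMeasure_beta_one hθ
  induction N generalizing x with
  | zero => rfl
  | succ N ih =>
    rw [stickIterate_succ, stickOperator, integral_congr_ae (g := fun _ => (1 : ℂ))]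
    · simp
    · filter_upwards [ae_betaMeasure_mem_Ioo 1 θ] with w hw
      rw [hφ1 _ (mul_le_of_mem_Ioo hε hx hw),
        ih (mul_le_of_mem_Ioo hε hx ⟨by linarith [hw.2], by linarith [hw.1]⟩), one_mul]

theorem norm_stickIterate_succ_sub_le (hθ : 0 < θ) (hε : 0 < ε) (hφc : Continuous φ)
    (hφ : ∀ x, ‖φ x‖ ≤ 1) (hφ1 : ∀ x ≤ ε, φ x = 1) (N : ℕ) {x : ℝ} (hx : 0 ≤ x) :
    ‖stickIterate θ φ (N + 1) x - stickIterate θ φ N x‖ ≤ 2 / ε * (θ / (1 + θ)) ^ N * x := by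
  have := isProbabilityMeasure_beta_one hθ
  induction N generalizing x with
  | zero =>
    rw [pow_zero, mul_one]
    rcases le_total x ε with h | h
    · rw [stickIterate_eq_one hθ hε hφ1 _ h, stickIterate_eq_one hθ hε hφ1 _ h, sub_self, norm_zero]
      positivity
    · have h1 := norm_stickIterate_le hθ hφ (0 + 1) x
      have h2 := norm_stickIterate_le hθ hφ 0 x
      refine (norm_sub_le _ _).trans ((add_le_add h1 h2).trans ?_)
      rw [div_mul_eq_mul_div, le_div_iff₀ hε]
      linarith
  | succ N ih =>
    have hc := continuous_stickIterate hθ hφc hφ N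
    have hc' := continuous_stickIterate hθ hφc hφ (N + 1)
    have e := congrFun (stickIterate_succ θ φ (N + 1)) x
    have e' := congrFun (stickIterate_succ θ φ N) x
    rw [stickOperator] at e e'
    rw [e, e', ← integral_sub
      (integrable_of_continuous_beta hθ (by fun_prop))
      (integrable_of_continuous_beta hθ (by fun_prop))]
    have h1 : 2 / ε * (θ / (1 + θ)) ^ (N + 1) * x
        = ∫ w, 2 / ε * (θ / (1 + θ)) ^ N * x * (1 - w) ∂(betaMeasure 1 θ) := by
      rw [integral_const_mul, integral_one_sub_beta hθ]; ring
    rw [h1]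
    refine norm_integral_le_of_norm_le (integrable_of_continuous_beta hθ (by fun_prop)) ?_
    filter_upwards [ae_betaMeasure_mem_Ioo 1 θ] with w hw
    rw [← mul_sub, norm_mul]
    have h2 := ih (x := x * (1 - w)) (mul_nonneg hx (by linarith [hw.2]))
    calc _ ≤ 1 * _ := mul_le_mul_of_nonneg_right (hφ _) (norm_nonneg _)
      _ ≤ _ := by rw [one_mul]; exact h2.trans (le_of_eq (by ring))

end Iterates

open unitInterval in
/-- The one-cycle recursion is asymptotically the stick breaking recursion, uniformly in the
remaining mass `x`. -/
theorem eventually_norm_sum_sub_stickOperator_le {θ ε : ℝ} (hθ : 0 < θ) {t : ℕ} (ht : 0 < t)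
    {F : ℝ → ℕ → ℂ} (hF : IsCycleFactor t ε F) {h : ℝ → ℂ} (hh : Continuous h) {η : ℝ}
    (hη : 0 < η) :
    ∀ᶠ m : ℕ in atTop, ∀ x ∈ Set.Icc (0 : ℝ) 1,
      ‖∑ ℓ ∈ Finset.Icc 1 m, (cycleKernel θ m ℓ : ℂ) * (F (x * (ℓ / m)) ℓ * h (x * (1 - ℓ / m)))
        - stickOperator θ (residueMean t F) h x‖ ≤ η := by
  have hFc := hF.continuous
  let G : ℕ → C(ℝ, C(I, ℂ)) := fun r => ContinuousMap.curry
    ⟨fun p : ℝ × I => F (p.2 * p.1) r * h (p.2 * (1 - p.1)), by fun_prop⟩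
  have hG : ∀ r w (x : I), G r w x = F (x * w) r * h (x * (1 - w)) := fun r w x => rfl
  have hper : Function.Periodic (fun r => (G r : ℝ → C(I, ℂ))) t := fun r => by
    funext w
    ext x
    rw [hG, hG, hF.periodic]
  have hlim := tendsto_sum_cycleKernel_periodic hθ ht hper fun r => (G r).continuous
  filter_upwards [(Metric.tendsto_nhds.1 hlim) η hη] with m hm x hx
  rw [dist_eq_norm] at hm
  refine le_trans (le_of_eq ?_) ((ContinuousMap.norm_coe_le_norm _ (⟨x, hx⟩ : I)).trans hm.le)
  have hint : (∫ w, (t : ℝ)⁻¹ • ∑ r ∈ Finset.range t, G r w ∂(betaMeasure 1 θ)) (⟨x, hx⟩ : I)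
      = stickOperator θ (residueMean t F) h x := by
    have h1 := ContinuousLinearMap.integral_comp_comm
      (ContinuousMap.evalCLM ℝ (⟨x, hx⟩ : I) : C(I, ℂ) →L[ℝ] ℂ)
      (φ := fun w => (t : ℝ)⁻¹ • ∑ r ∈ Finset.range t, G r w) (μ := betaMeasure 1 θ)
      (integrable_of_continuous_beta hθ (by fun_prop))
    refine h1.symm.trans (integral_congr_ae (ae_of_all _ fun w => ?_))
    simp only [map_smul, map_sum, ContinuousMap.evalCLM_apply, hG, residueMean]
    rw [smul_mul_assoc, Finset.sum_mul]
  rw [ContinuousMap.sub_apply, hint]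
  congr 2
  rw [ContinuousMap.sum_apply]
  refine Finset.sum_congr rfl fun ℓ _ => ?_
  rw [ContinuousMap.smul_apply, hG, Complex.real_smul]

section EwensLimit

variable {θ ε : ℝ} {t : ℕ} {F : ℝ → ℕ → ℂ}

theorem ewensProduct_eq_one (hθ : 0 < θ) {G : ℕ → ℂ} {m : ℕ}
    (hG : ∀ ℓ ≤ m, G ℓ = 1) : ewensProduct θ G m = 1 := by
  induction m using Nat.strong_induction_on with
  | _ m ih =>
    rcases Nat.eq_zero_or_pos m with rfl | hm
    · exact ewensProduct_zero θ G
    · rw [ewensProduct_eq_sum hθ G hm, ← Complex.ofReal_one, ← sum_cycleKernel hθ hm,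
        Complex.ofReal_sum]
      refine Finset.sum_congr rfl fun ℓ hℓ => ?_
      obtain ⟨h1, h2⟩ := Finset.mem_Icc.1 hℓ
      rw [hG ℓ h2, ih (m - ℓ) (by omega) fun k hk => hG k (by omega), mul_one, mul_one]

/-- Comparison of the recursion for Ewens permutations with the iterates of the stick breaking
operator. The linear function `m ↦ D (1 + θ) m / (ε n)` is a supersolution of the error recursion
because on average a cycle takes the proportion `1 / (1 + θ)` of the points. -/
theorem norm_ewensProduct_sub_stickIterate_le (hθ : 0 < θ) (hε : 0 < ε) (ht : 0 < t)
    (hF : IsCycleFactor t ε F) (N : ℕ) {η : ℝ} (hη : 0 < η) :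
    ∀ᶠ n : ℕ in atTop,
      ‖ewensProduct θ (fun ℓ => F (ℓ / n) ℓ) n - stickIterate θ (residueMean t F) N 1‖
        ≤ (η + 2 / ε * (θ / (1 + θ)) ^ N) * ((1 + θ) / ε) := by
  have hφc := hF.continuous_residueMean
  have hφ := hF.norm_residueMean_le
  have hφ1 : ∀ x ≤ ε, residueMean t F x = 1 := fun x hx => hF.residueMean_eq_one ht hx
  have hc := continuous_stickIterate hθ hφc hφ N
  obtain ⟨M, hM⟩ := eventually_atTop.1 (eventually_norm_sum_sub_stickOperator_le hθ ht hF hc hη)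
  obtain ⟨n₀, hn₀⟩ := exists_nat_gt (M / ε)
  filter_upwards [eventually_ge_atTop (max n₀ 1)] with n hn
  have hn1 : 0 < n := lt_of_lt_of_le one_pos ((le_max_right _ _).trans hn)
  have hn1' : (0 : ℝ) < n := by exact_mod_cast hn1
  have hnM : (M : ℝ) < ε * n := by
    rw [div_lt_iff₀ hε] at hn₀
    refine hn₀.trans_le ?_
    rw [mul_comm]
    exact mul_le_mul_of_nonneg_left (by exact_mod_cast (le_max_left _ _).trans hn) hε.le
  set φ := residueMean t F with hφdef
  set a := ewensProduct θ (fun ℓ => F (ℓ / n) ℓ) with ha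
  set h := stickIterate θ φ N with hh
  set D := η + 2 / ε * (θ / (1 + θ)) ^ N with hD
  have hD0 : 0 ≤ D := by positivity
  have key : ∀ m ≤ n, ‖a m - h (m / n)‖ ≤ D * ((1 + θ) / (ε * n)) * m := by
    intro m
    induction m using Nat.strong_induction_on with
    | _ m ih =>
      intro hmn
      rcases le_or_gt ((m : ℝ) / n) ε with hsmall | hlarge
      · rw [hh, stickIterate_eq_one hθ hε hφ1 N hsmall, ha, ewensProduct_eq_one hθ fun ℓ hℓ =>
          hF.eq_one _ (le_trans (by gcongr) hsmall) _, sub_self, norm_zero]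
        positivity
      · have hmε : ε * n < m := (lt_div_iff₀ hn1').1 hlarge
        have hmM : M ≤ m := by exact_mod_cast (hnM.trans hmε).le
        have hm0' : (0 : ℝ) < m := lt_trans (by positivity) hmε
        have hm0 : 0 < m := by exact_mod_cast hm0'
        have hx : (m : ℝ) / n ∈ Set.Icc (0 : ℝ) 1 :=
          ⟨by positivity, div_le_one_of_le₀ (by exact_mod_cast hmn) hn1'.le⟩
        have hstep : ‖∑ ℓ ∈ Finset.Icc 1 m, (cycleKernel θ m ℓ : ℂ)
              * (F (ℓ / n) ℓ * h (((m - ℓ : ℕ) : ℝ) / n))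
              - stickIterate θ φ (N + 1) (m / n)‖ ≤ η := by
          rw [stickIterate_succ]
          refine le_trans (le_of_eq ?_) (hM m hmM _ hx)
          congr 2
          refine Finset.sum_congr rfl fun ℓ hℓ => ?_
          have hℓm := (Finset.mem_Icc.1 hℓ).2
          rw [show (m : ℝ) / n * (ℓ / m) = ℓ / n by field_simp,
            show (m : ℝ) / n * (1 - ℓ / m) = ((m - ℓ : ℕ) : ℝ) / n by
              rw [Nat.cast_sub hℓm]; field_simp]
        have hiter := norm_stickIterate_succ_sub_le hθ hε hφc hφ hφ1 N hx.1
        have hrec : ‖∑ ℓ ∈ Finset.Icc 1 m, (cycleKernel θ m ℓ : ℂ)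
              * (F (ℓ / n) ℓ * (a (m - ℓ) - h (((m - ℓ : ℕ) : ℝ) / n)))‖
            ≤ D * ((1 + θ) / (ε * n)) * (m * (θ / (1 + θ))) := by
          calc _ ≤ ∑ ℓ ∈ Finset.Icc 1 m, D * ((1 + θ) / (ε * n))
                  * (cycleKernel θ m ℓ * ((m - ℓ : ℕ) : ℝ)) := by
                refine norm_sum_le_of_le _ fun ℓ hℓ => ?_
                obtain ⟨h1, h2⟩ := Finset.mem_Icc.1 hℓ
                have hk := cycleKernel_nonneg hθ m ℓ
                rw [norm_mul, norm_mul, Complex.norm_of_nonneg hk]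
                have h3 := ih (m - ℓ) (by omega) (by omega)
                have h4 : ‖F (ℓ / n) ℓ‖ * ‖a (m - ℓ) - h (((m - ℓ : ℕ) : ℝ) / n)‖
                    ≤ D * ((1 + θ) / (ε * n)) * ((m - ℓ : ℕ) : ℝ) :=
                  (mul_le_of_le_one_left (norm_nonneg _) (hF.norm_le _ _)).trans h3
                exact (mul_le_mul_of_nonneg_left h4 hk).trans (le_of_eq (by ring))
            _ ≤ _ := by
                rw [← Finset.mul_sum]
                exact mul_le_mul_of_nonneg_left (sum_cycleKernel_mul_sub_le hθ hm0) (by positivity)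
        have hdec : a m - h (m / n) = ∑ ℓ ∈ Finset.Icc 1 m, (cycleKernel θ m ℓ : ℂ)
              * (F (ℓ / n) ℓ * (a (m - ℓ) - h (((m - ℓ : ℕ) : ℝ) / n)))
            + (∑ ℓ ∈ Finset.Icc 1 m, (cycleKernel θ m ℓ : ℂ)
              * (F (ℓ / n) ℓ * h (((m - ℓ : ℕ) : ℝ) / n)) - stickIterate θ φ (N + 1) (m / n))
            + (stickIterate θ φ (N + 1) (m / n) - h (m / n)) := by
          have e : a m = ∑ ℓ ∈ Finset.Icc 1 m, (cycleKernel θ m ℓ : ℂ)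
              * (F (ℓ / n) ℓ * (a (m - ℓ) - h (((m - ℓ : ℕ) : ℝ) / n)))
              + ∑ ℓ ∈ Finset.Icc 1 m, (cycleKernel θ m ℓ : ℂ)
              * (F (ℓ / n) ℓ * h (((m - ℓ : ℕ) : ℝ) / n)) := by
            rw [ha, ewensProduct_eq_sum hθ _ hm0, ← Finset.sum_add_distrib]
            refine Finset.sum_congr rfl fun ℓ _ => by ring
          rw [e]; ring
        rw [hdec]
        refine (norm_add₃_le).trans ((add_le_add (add_le_add hrec hstep) hiter).trans ?_)
        have h5 : D ≤ D * ((1 + θ) / (ε * n)) * m * (1 / (1 + θ)) := by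
          have : D * ((1 + θ) / (ε * n)) * m * (1 / (1 + θ)) = D * (m / (ε * n)) := by field_simp
          rw [this]
          exact le_mul_of_one_le_right hD0 ((one_le_div (by positivity)).2 hmε.le)
        have h6 : 2 / ε * (θ / (1 + θ)) ^ N * (m / n) ≤ 2 / ε * (θ / (1 + θ)) ^ N :=
          mul_le_of_le_one_right (by positivity) hx.2
        have h7 : D * ((1 + θ) / (ε * n)) * m = D * ((1 + θ) / (ε * n)) * (m * (θ / (1 + θ)))
            + D * ((1 + θ) / (ε * n)) * m * (1 / (1 + θ)) := by field_simp; ring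
        rw [h7, add_assoc]
        refine add_le_add le_rfl (le_trans ?_ h5)
        rw [hD]
        exact add_le_add le_rfl h6
  have := key n le_rfl
  rw [div_self hn1'.ne'] at this
  refine this.trans (le_of_eq ?_)
  field_simp

theorem tendsto_ewensProduct (hθ : 0 < θ) (hε : 0 < ε) (ht : 0 < t) (hF : IsCycleFactor t ε F)
    {c : ℂ} (hc : Tendsto (fun N => stickIterate θ (residueMean t F) N 1) atTop (nhds c)) :
    Tendsto (fun n : ℕ => ewensProduct θ (fun ℓ => F (ℓ / n) ℓ) n) atTop (nhds c) := by
  rw [Metric.tendsto_nhds]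
  intro δ hδ
  have hgeom : Tendsto (fun N : ℕ => 2 / ε * (θ / (1 + θ)) ^ N * ((1 + θ) / ε)) atTop (nhds 0) := by
    have := (tendsto_pow_atTop_nhds_zero_of_lt_one (r := θ / (1 + θ)) (by positivity)
      ((div_lt_one (by positivity)).2 (by linarith))).const_mul (2 / ε)
    simpa using this.mul_const ((1 + θ) / ε)
  obtain ⟨N, hN1, hN2⟩ := ((hgeom.eventually_lt_const (by positivity : 0 < δ / 3)).and
    ((Metric.tendsto_nhds.1 hc) (δ / 3) (by positivity))).exists
  have hη : 0 < δ / 3 / ((1 + θ) / ε) := by positivity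
  filter_upwards [norm_ewensProduct_sub_stickIterate_le hθ hε ht hF N hη] with n hn
  rw [add_mul, div_mul_cancel₀ _ (by positivity), ← dist_eq_norm] at hn
  calc _ ≤ _ := dist_triangle _ (stickIterate θ (residueMean t F) N 1) _
    _ < δ := by linarith

end EwensLimit

/-! ### Stick breaking -/

/-- The sequence with first term `a` followed by the sequence `w`. -/
def seqCons (a : ℝ) (w : ℕ → ℝ) : ℕ → ℝ
  | 0 => a
  | n + 1 => w n

theorem continuous_seqCons : Continuous fun p : ℝ × (ℕ → ℝ) => seqCons p.1 p.2 := by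
  refine continuous_pi fun n => ?_
  cases n with
  | zero => exact continuous_fst
  | succ n => exact (continuous_apply n).comp continuous_snd

theorem map_seqCons_prod_infinitePi (β : Measure ℝ) [IsProbabilityMeasure β] :
    (β.prod (Measure.infinitePi fun _ : ℕ => β)).map (fun p => seqCons p.1 p.2)
      = Measure.infinitePi fun _ : ℕ => β := by
  refine Measure.eq_infinitePi _ fun s A hA => ?_
  classical
  obtain ⟨n, hn⟩ : ∃ n, s ⊆ Finset.range (n + 1) := by
    obtain ⟨n, hn⟩ := s.bddAbove
    exact ⟨n, fun i hi => Finset.mem_range.2 (Nat.lt_succ_of_le (hn hi))⟩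
  let B : ℕ → Set ℝ := fun i => if i ∈ s then A i else Set.univ
  have hB : ∀ i, MeasurableSet (B i) := fun i => by
    by_cases hi : i ∈ s
    · simpa [B, hi] using hA i
    · simp [B, hi]
  have hpi : Set.pi (s : Set ℕ) A = Set.pi (Finset.range (n + 1) : Set ℕ) B := by
    ext w
    simp only [Set.mem_pi, Finset.mem_coe]
    constructor
    · intro h i _
      by_cases hi : i ∈ s
      · simpa [B, hi] using h i hi
      · simp [B, hi]
    · intro h i hi
      simpa [B, hi] using h i (hn hi)
  have hprod : ∏ i ∈ s, β (A i) = ∏ i ∈ Finset.range (n + 1), β (B i) := by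
    rw [← Finset.prod_subset hn (f := fun i => β (B i))]
    · exact Finset.prod_congr rfl fun i hi => by simp [B, hi]
    · intro i _ hi
      simp [B, hi]
  have hpre : (fun p : ℝ × (ℕ → ℝ) => seqCons p.1 p.2) ⁻¹' Set.pi (Finset.range (n + 1) : Set ℕ) B
      = B 0 ×ˢ Set.pi (Finset.range n : Set ℕ) fun i => B (i + 1) := by
    ext p
    simp only [Set.mem_preimage, Set.mem_pi, Finset.mem_coe, Finset.mem_range, Set.mem_prod]
    constructor
    · intro h
      exact ⟨h 0 n.succ_pos, fun i hi => h (i + 1) (Nat.succ_lt_succ hi)⟩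
    · rintro ⟨h0, h⟩ i hi
      cases i with
      | zero => exact h0
      | succ i => exact h i (Nat.lt_of_succ_lt_succ hi)
  rw [hpi, Measure.map_apply continuous_seqCons.measurable
    (MeasurableSet.pi (Finset.countable_toSet _) fun i _ => hB i), hpre, Measure.prod_prod,
    Measure.infinitePi_pi _ fun i _ => hB (i + 1), hprod, Finset.prod_range_succ', mul_comm]

theorem stickBreaking_seqCons_zero (a : ℝ) (w : ℕ → ℝ) : stickBreaking (seqCons a w) 0 = a := by
  simp [stickBreaking, seqCons]

theorem stickBreaking_seqCons_succ (a : ℝ) (w : ℕ → ℝ) (i : ℕ) :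
    stickBreaking (seqCons a w) (i + 1) = (1 - a) * stickBreaking w i := by
  simp only [stickBreaking, Finset.prod_range_succ', seqCons]
  ring

theorem continuous_stickBreaking : Continuous stickBreaking := by
  unfold stickBreaking
  fun_prop

theorem continuous_stickBreaking_apply (i : ℕ) : Continuous fun w => stickBreaking w i :=
  (continuous_apply i).comp continuous_stickBreaking

theorem stickIterate_eq_integral {θ : ℝ} (hθ : 0 < θ) {φ : ℝ → ℂ} (hφc : Continuous φ)
    (hφ : ∀ x, ‖φ x‖ ≤ 1) (N : ℕ) (x : ℝ) :
    stickIterate θ φ N x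
      = ∫ w, ∏ i ∈ Finset.range N, φ (x * stickBreaking w i)
          ∂(Measure.infinitePi fun _ : ℕ => betaMeasure 1 θ) := by
  have := isProbabilityMeasure_beta_one hθ
  have hcont : ∀ (N : ℕ) (x : ℝ),
      Continuous fun w => ∏ i ∈ Finset.range N, φ (x * stickBreaking w i) := fun N x =>
    continuous_finsetProd _ fun i _ =>
      hφc.comp (continuous_const.mul (continuous_stickBreaking_apply i))
  induction N generalizing x with
  | zero => simp [stickIterate]
  | succ N ih =>
    rw [← map_seqCons_prod_infinitePi, integral_map continuous_seqCons.aemeasurable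
      (hcont _ x).aestronglyMeasurable, integral_prod]
    · rw [stickIterate_succ, stickOperator]
      refine integral_congr_ae (ae_of_all _ fun a => ?_)
      simp only [Finset.prod_range_succ', stickBreaking_seqCons_zero, stickBreaking_seqCons_succ]
      rw [integral_mul_const, ih, mul_comm]
      simp only [mul_assoc]
    · refine Integrable.of_bound ((hcont _ x).comp continuous_seqCons).aestronglyMeasurable 1
        (ae_of_all _ fun p => ?_)
      rw [norm_prod]
      exact Finset.prod_le_one (fun _ _ => norm_nonneg _) fun _ _ => hφ _

/-- The properties of the lengths of the pieces of a broken stick that hold almost surely: they are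
positive, and any finitely many of them have sum at most `1`. -/
structure IsStickSequence (v : ℕ → ℝ) : Prop where
  pos : ∀ i, 0 < v i
  sum_le : ∀ N, ∑ i ∈ Finset.range N, v i ≤ 1

theorem sum_stickBreaking (w : ℕ → ℝ) (N : ℕ) :
    ∑ i ∈ Finset.range N, stickBreaking w i = 1 - ∏ j ∈ Finset.range N, (1 - w j) := by
  induction N with
  | zero => simp
  | succ N ih =>
    rw [Finset.sum_range_succ, ih, Finset.prod_range_succ, stickBreaking]
    ring

theorem ae_isStickSequence {θ : ℝ} (hθ : 0 < θ) :
    ∀ᵐ w ∂(Measure.infinitePi fun _ : ℕ => betaMeasure 1 θ), IsStickSequence (stickBreaking w) := by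
  have := isProbabilityMeasure_beta_one hθ
  have h : ∀ᵐ w ∂(Measure.infinitePi fun _ : ℕ => betaMeasure 1 θ), ∀ i, w i ∈ Set.Ioo (0 : ℝ) 1 :=
    ae_all_iff.2 fun i => (measurePreserving_eval_infinitePi
      (fun _ : ℕ => betaMeasure 1 θ) i).quasiMeasurePreserving.ae (ae_betaMeasure_mem_Ioo 1 θ)
  filter_upwards [h] with w hw
  have hpos : ∀ N, 0 < ∏ j ∈ Finset.range N, (1 - w j) := fun N =>
    Finset.prod_pos fun j _ => by linarith [(hw j).2]
  refine ⟨fun i => mul_pos (hw i).1 (hpos i), fun N => ?_⟩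
  rw [sum_stickBreaking]
  linarith [hpos N]

namespace IsStickSequence

variable {v : ℕ → ℝ}

theorem le_one (hv : IsStickSequence v) (i : ℕ) : v i ≤ 1 :=
  (Finset.single_le_sum (fun j _ => (hv.pos j).le) (Finset.self_mem_range_succ i)).trans
    (hv.sum_le (i + 1))

theorem tendsto_zero (hv : IsStickSequence v) : Tendsto v atTop (nhds 0) :=
  (summable_of_sum_range_le (fun i => (hv.pos i).le) hv.sum_le).tendsto_atTop_zero

theorem exists_forall_le (hv : IsStickSequence v) {ε : ℝ} (hε : 0 < ε) : ∃ N, ∀ i ≥ N, v i ≤ ε :=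
  eventually_atTop.1 (hv.tendsto_zero.eventually_le_const hε)

theorem finite_lt (hv : IsStickSequence v) {ε : ℝ} (hε : 0 < ε) : {i | ε < v i}.Finite := by
  obtain ⟨N, hN⟩ := hv.exists_forall_le hε
  exact (Finset.range N).finite_toSet.subset fun i hi => by
    by_contra h
    exact absurd (hN i (by simpa using h)) (not_le.2 hi)

end IsStickSequence

/-! ### Decreasing rearrangements -/

theorem countP_lt_eq_countP_lt_add_count {A : Multiset ℝ} {c b : ℝ} (hcb : c < b)
    (h : ∀ x ∈ A, c < x → b ≤ x) :
    A.countP (fun x => c < x) = A.countP (fun x => b < x) + A.count b := by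
  induction A using Multiset.induction_on with
  | empty => simp
  | cons x A ih =>
    have ih := ih fun y hy => h y (Multiset.mem_cons_of_mem hy)
    have hx := h x (Multiset.mem_cons_self x A)
    rw [Multiset.countP_cons, Multiset.countP_cons, Multiset.count_cons, ih]
    by_cases h1 : c < x
    · rcases (hx h1).eq_or_lt with h2 | h2
      · subst h2
        simp [hcb]
        ring
      · rw [if_pos h1, if_pos h2, if_neg h2.ne]
        ring
    · rw [if_neg h1, if_neg fun h2 => h1 (hcb.trans h2),
        if_neg fun h2 : b = x => h1 (h2 ▸ hcb)]
      omega

/-- A finite multiset of reals above `ε` is determined by the numbers of its elements above each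
level `c ≥ ε`. -/
theorem multiset_eq_of_countP_lt {A B : Multiset ℝ} {ε : ℝ} (hA : ∀ x ∈ A, ε < x)
    (hB : ∀ x ∈ B, ε < x)
    (h : ∀ c, ε ≤ c → A.countP (fun x => c < x) = B.countP (fun x => c < x)) : A = B := by
  classical
  refine Multiset.ext.2 fun b => ?_
  by_cases hb : ε < b
  · -- a level `c < b` with no element of `A` or `B` strictly between `c` and `b`
    let T := insert ε ((A + B).toFinset.filter fun x => x < b)
    have hT : T.Nonempty := ⟨ε, Finset.mem_insert_self _ _⟩
    let c := T.max' hT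
    have hcε : ε ≤ c := Finset.le_max' _ _ (Finset.mem_insert_self _ _)
    have hcb : c < b := by
      rw [Finset.max'_lt_iff]
      intro y hy
      rcases Finset.mem_insert.1 hy with rfl | hy
      · exact hb
      · exact (Finset.mem_filter.1 hy).2
    have hgap : ∀ x ∈ A + B, c < x → b ≤ x := by
      intro x hx hcx
      by_contra hxb
      refine absurd (Finset.le_max' T x ?_) (not_le.2 hcx)
      exact Finset.mem_insert_of_mem
        (Finset.mem_filter.2 ⟨Multiset.mem_toFinset.2 hx, not_le.1 hxb⟩)
    have h1 := countP_lt_eq_countP_lt_add_count hcb fun x hx =>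
      hgap x (Multiset.mem_add.2 (Or.inl hx))
    have h2 := countP_lt_eq_countP_lt_add_count hcb fun x hx =>
      hgap x (Multiset.mem_add.2 (Or.inr hx))
    have h3 := h c hcε
    have h4 := h b hb.le
    omega
  · rw [Multiset.count_eq_zero_of_notMem fun hb' => hb (hA b hb'),
      Multiset.count_eq_zero_of_notMem fun hb' => hb (hB b hb')]

section Rearrangement

variable {v : ℕ → ℝ}

theorem bddAbove_range_inf' (hv : ∀ i, v i ≤ 1) (i : ℕ) :
    BddAbove (Set.range fun s : {s : Finset ℕ // s.card = i + 1} =>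
      s.1.inf' (Finset.card_pos.1 (by rw [s.2]; exact Nat.succ_pos i)) v) := by
  refine ⟨1, ?_⟩
  rintro _ ⟨s, rfl⟩
  obtain ⟨j, hj⟩ := Finset.card_pos.1 (by rw [s.2]; exact Nat.succ_pos i)
  exact (Finset.inf'_le v hj).trans (hv j)

theorem nonempty_finset_card_eq (i : ℕ) : Nonempty {s : Finset ℕ // s.card = i + 1} :=
  ⟨⟨Finset.range (i + 1), Finset.card_range _⟩⟩

/-- The `i`-th largest entry exceeds `c` if and only if more than `i` entries exceed `c`. -/
theorem lt_decreasingRearrangement_iff (hv : ∀ i, v i ≤ 1) {c : ℝ} {S : Finset ℕ}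
    (hS : ∀ i, i ∈ S ↔ c < v i) (i : ℕ) : c < decreasingRearrangement v i ↔ i < S.card := by
  have := nonempty_finset_card_eq i
  rw [decreasingRearrangement, lt_ciSup_iff (bddAbove_range_inf' hv i)]
  constructor
  · rintro ⟨s, hs⟩
    rw [Finset.lt_inf'_iff] at hs
    have : s.1 ⊆ S := fun j hj => (hS j).2 (hs j hj)
    have := Finset.card_le_card this
    have := s.2
    omega
  · intro hi
    obtain ⟨s, hsS, hs⟩ := Finset.exists_subset_card_eq (Nat.succ_le_of_lt hi)
    exact ⟨⟨s, hs⟩, (Finset.lt_inf'_iff _).2 fun j hj => (hS j).1 (hsS hj)⟩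

theorem decreasingRearrangement_nonneg (hv0 : ∀ i, 0 ≤ v i) (hv : ∀ i, v i ≤ 1) (i : ℕ) :
    0 ≤ decreasingRearrangement v i := by
  obtain ⟨s⟩ := nonempty_finset_card_eq i
  exact le_ciSup_of_le (bddAbove_range_inf' hv i) s ((Finset.le_inf'_iff _ _).2 fun j _ => hv0 j)

/-- Beyond the entries larger than `ε`, the rearrangement has no entry larger than `ε`, and a
product that ignores entries up to `ε` is invariant under rearrangement. -/
theorem exists_prod_decreasingRearrangement_eq (hv : ∀ i, v i ≤ 1) {ε : ℝ}
    (hfin : {i | ε < v i}.Finite) :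
    ∃ k, (∀ i ≥ k, decreasingRearrangement v i ≤ ε) ∧
      ∀ φ : ℝ → ℂ, ∏ i ∈ Finset.range k, φ (decreasingRearrangement v i)
        = ∏ i ∈ hfin.toFinset, φ (v i) := by
  classical
  set S := hfin.toFinset with hS
  have hmemS : ∀ i, i ∈ S ↔ ε < v i := fun i => by simp [hS]
  have hlev := lt_decreasingRearrangement_iff hv hmemS
  refine ⟨S.card, fun i hi => not_lt.1 fun h => absurd ((hlev i).1 h) (not_lt.2 hi), fun φ => ?_⟩
  have hmulti : (Finset.range S.card).val.map (decreasingRearrangement v) = S.val.map v := by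
    refine multiset_eq_of_countP_lt (ε := ε) ?_ ?_ ?_
    · intro x hx
      obtain ⟨i, hi, rfl⟩ := Multiset.mem_map.1 hx
      exact (hlev i).2 (Finset.mem_range.1 hi)
    · intro x hx
      obtain ⟨i, hi, rfl⟩ := Multiset.mem_map.1 hx
      exact (hmemS i).1 hi
    · intro c hc
      let Sc := S.filter fun i => c < v i
      have hmem : ∀ i, i ∈ Sc ↔ c < v i := fun i => by
        simp only [Sc, Finset.mem_filter, hmemS]
        exact ⟨fun h => h.2, fun h => ⟨hc.trans_lt h, h⟩⟩
      have hcard : Sc.card ≤ S.card := Finset.card_filter_le _ _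
      have e1 : (Finset.range S.card).filter (fun i => c < decreasingRearrangement v i)
          = Finset.range Sc.card := by
        ext i
        rw [Finset.mem_filter, lt_decreasingRearrangement_iff hv hmem, Finset.mem_range,
          Finset.mem_range]
        omega
      rw [Multiset.countP_map, Multiset.countP_map]
      have e2 := congrArg Finset.card e1
      rw [Finset.card_range] at e2
      exact e2
  have := congrArg (fun A => (A.map φ).prod) hmulti
  rw [Multiset.map_map, Multiset.map_map] at this
  exact this

theorem measurable_decreasingRearrangement : Measurable decreasingRearrangement := by
  refine measurable_pi_lambda _ fun i => ?_
  refine Measurable.iSup fun s => Continuous.measurable ?_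
  exact Continuous.finset_inf'_apply _ fun j _ => continuous_apply j

end Rearrangement

/-! ### Multiplicative functionals of Poisson–Dirichlet sequences -/

theorem tendsto_prod_range_finprod {l : ℕ → ℂ} {S : Finset ℕ} (h : ∀ i, i ∉ S → l i = 1) :
    Tendsto (fun N => ∏ i ∈ Finset.range N, l i) atTop (nhds (∏ᶠ i, l i)) := by
  have h1 : ∏ᶠ i, l i = ∏ i ∈ S, l i :=
    finprod_eq_prod_of_mulSupport_subset _ fun i hi => by
      by_contra hiS
      exact hi (h i hiS)
  obtain ⟨n, hn⟩ := S.bddAbove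
  rw [h1]
  refine tendsto_const_nhds.congr' ?_
  filter_upwards [eventually_gt_atTop n] with N hN
  refine Finset.prod_subset (fun i hi => Finset.mem_range.2 (lt_of_le_of_lt (hn hi) hN))
    fun i _ hi => h i hi

theorem norm_prod_le_one {ι : Type*} {s : Finset ι} {f : ι → ℂ} (h : ∀ i, ‖f i‖ ≤ 1) :
    ‖∏ i ∈ s, f i‖ ≤ 1 := by
  rw [norm_prod]
  exact Finset.prod_le_one (fun _ _ => norm_nonneg _) fun _ _ => h _

/-- A factor that ignores small pieces has the same infinite product over a stick sequence and
over its decreasing rearrangement. -/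
theorem IsStickSequence.finprod_decreasingRearrangement {v : ℕ → ℝ} (hv : IsStickSequence v)
    {ε : ℝ} (hε : 0 < ε) {φ : ℝ → ℂ} (hφ1 : ∀ x ≤ ε, φ x = 1) :
    ∏ᶠ i, φ (decreasingRearrangement v i) = ∏ᶠ i, φ (v i) := by
  obtain ⟨k, hk, hprod⟩ := exists_prod_decreasingRearrangement_eq hv.le_one (hv.finite_lt hε)
  rw [finprod_eq_prod_of_mulSupport_subset (s := Finset.range k),
    finprod_eq_prod_of_mulSupport_subset (s := (hv.finite_lt hε).toFinset), hprod]
  · intro i hi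
    by_contra h
    exact hi (hφ1 _ (by simpa using h))
  · intro i hi
    by_contra h
    exact hi (hφ1 _ (hk i (by simpa using h)))

section LimitFunctional

variable {θ ε : ℝ} {φ : ℝ → ℂ}

/-- The expectation of the infinite product `∏ φ(Vᵢ)` over a `GEM(θ)` sequence `V`. -/
noncomputable def gemProduct (θ : ℝ) (φ : ℝ → ℂ) : ℂ :=
  ∫ w, ∏ᶠ i, φ (stickBreaking w i) ∂(Measure.infinitePi fun _ : ℕ => betaMeasure 1 θ)

theorem tendsto_stickIterate_one (hθ : 0 < θ) (hε : 0 < ε) (hφc : Continuous φ)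
    (hφ : ∀ x, ‖φ x‖ ≤ 1) (hφ1 : ∀ x ≤ ε, φ x = 1) :
    Tendsto (fun N => stickIterate θ φ N 1) atTop (nhds (gemProduct θ φ)) := by
  have := isProbabilityMeasure_beta_one hθ
  simp only [stickIterate_eq_integral hθ hφc hφ, one_mul]
  refine tendsto_integral_of_dominated_convergence (fun _ => 1) (fun N => ?_) (integrable_const _)
    (fun N => ae_of_all _ fun w => norm_prod_le_one fun _ => hφ _) ?_
  · exact (continuous_finsetProd _ fun i _ =>
      hφc.comp (continuous_stickBreaking_apply i)).aestronglyMeasurable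
  · filter_upwards [ae_isStickSequence hθ] with w hw
    exact tendsto_prod_range_finprod (S := (hw.finite_lt hε).toFinset) fun i hi =>
      hφ1 _ (by simpa using hi)

variable {Ω : Type*} [MeasurableSpace Ω] {P : Measure Ω} {L : ℕ → Ω → ℝ}

theorem map_infinitePi_eq_poissonDirichlet (θ : ℝ) :
    (Measure.infinitePi fun _ : ℕ => betaMeasure 1 θ).map
      (fun w => decreasingRearrangement (stickBreaking w)) = poissonDirichlet θ := by
  rw [poissonDirichlet, gemMeasure, Measure.map_map measurable_decreasingRearrangement
    continuous_stickBreaking.measurable]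
  rfl

theorem tendsto_integral_prod_poissonDirichlet (hθ : 0 < θ) (hε : 0 < ε) (hφc : Continuous φ)
    (hφ : ∀ x, ‖φ x‖ ≤ 1) (hφ1 : ∀ x ≤ ε, φ x = 1)
    (hL : HasLaw (fun ω i => L i ω) (poissonDirichlet θ) P) :
    Tendsto (fun N => ∫ ω, ∏ i ∈ Finset.range N, φ (L i ω) ∂P) atTop
      (nhds (gemProduct θ φ)) := by
  have := isProbabilityMeasure_beta_one hθ
  have hcont : ∀ N, Continuous fun l : ℕ → ℝ => ∏ i ∈ Finset.range N, φ (l i) := fun N =>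
    continuous_finsetProd _ fun i _ => hφc.comp (continuous_apply i)
  have hmeas : Measurable fun w => decreasingRearrangement (stickBreaking w) :=
    measurable_decreasingRearrangement.comp continuous_stickBreaking.measurable
  have e : ∀ N, ∫ ω, ∏ i ∈ Finset.range N, φ (L i ω) ∂P
      = ∫ w, ∏ i ∈ Finset.range N, φ (decreasingRearrangement (stickBreaking w) i)
        ∂(Measure.infinitePi fun _ : ℕ => betaMeasure 1 θ) := fun N => by
    have h1 := hL.integral_comp (f := fun l : ℕ → ℝ => ∏ i ∈ Finset.range N, φ (l i))
      (hcont N).aestronglyMeasurable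
    rw [← map_infinitePi_eq_poissonDirichlet, integral_map hmeas.aemeasurable
      (hcont N).aestronglyMeasurable] at h1
    exact h1
  simp only [e]
  refine tendsto_integral_of_dominated_convergence (fun _ => 1) (fun N => ?_) (integrable_const _)
    (fun N => ae_of_all _ fun w => norm_prod_le_one fun _ => hφ _) ?_
  · exact ((hcont N).measurable.comp hmeas).aestronglyMeasurable
  · filter_upwards [ae_isStickSequence hθ] with w hw
    rw [← hw.finprod_decreasingRearrangement hε hφ1]
    obtain ⟨k, hk, -⟩ := exists_prod_decreasingRearrangement_eq hw.le_one (hw.finite_lt hε)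
    exact tendsto_prod_range_finprod (S := Finset.range k) fun i hi =>
      hφ1 _ (hk i (by simpa using hi))

/-- A Poisson–Dirichlet sequence lies in `[0, 1]` and has finitely many entries above any
`ε > 0`. -/
theorem ae_poissonDirichlet (hθ : 0 < θ) (hε : 0 < ε)
    (hL : HasLaw (fun ω i => L i ω) (poissonDirichlet θ) P) :
    ∀ᵐ ω ∂P, (∀ i, 0 ≤ L i ω) ∧ ∃ N, ∀ i ≥ N, L i ω ≤ ε := by
  have hp : Measurable fun l : ℕ → ℝ => (∀ i, 0 ≤ l i) ∧ ∃ N, ∀ i ≥ N, l i ≤ ε :=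
    (Measurable.forall fun i => measurableSet_setOfPred.1
      (measurableSet_le measurable_const (measurable_pi_apply i))).and
    (Measurable.exists fun N => Measurable.forall fun i => measurable_const.imp
      (measurableSet_setOfPred.1 (measurableSet_le (measurable_pi_apply i) measurable_const)))
  refine (hL.ae_iff hp).2 ?_
  rw [← map_infinitePi_eq_poissonDirichlet]
  refine (ae_map_iff (measurable_decreasingRearrangement.comp
    continuous_stickBreaking.measurable).aemeasurable hp.setOf).2 ?_
  filter_upwards [ae_isStickSequence hθ] with w hw
  obtain ⟨k, hk, -⟩ := exists_prod_decreasingRearrangement_eq hw.le_one (hw.finite_lt hε)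
  exact ⟨decreasingRearrangement_nonneg (fun i => (hw.pos i).le) hw.le_one, k, hk⟩

/-! ### Uniform residues -/

/-- The index `m` of the fraction `u = m / t`. -/
noncomputable def fractionIndex (t : ℕ) (u : ℝ) : ℕ := ⌊(t : ℝ) * u⌋₊

theorem fractionIndex_div {t : ℕ} (ht : 0 < t) (m : ℕ) : fractionIndex t ((m : ℝ) / t) = m := by
  have ht' : (t : ℝ) ≠ 0 := by exact_mod_cast ht.ne'
  rw [fractionIndex, mul_div_cancel₀ _ ht', Nat.floor_natCast]

theorem measurable_fractionIndex (t : ℕ) : Measurable (fractionIndex t) :=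
  Nat.measurable_floor.comp (measurable_const_mul _)

theorem uniformFractions_eq_uniformOn_finset (t : ℕ) :
    uniformFractions t = uniformOn (((Finset.Icc 1 t).image fun m : ℕ => (m : ℝ) / t : Finset ℝ) :
      Set ℝ) := by
  simp [uniformFractions]

theorem injective_div_natCast {t : ℕ} (ht : 0 < t) :
    Function.Injective fun m : ℕ => (m : ℝ) / t := fun a b hab => by
  have ht' : (t : ℝ) ≠ 0 := by exact_mod_cast ht.ne'
  exact_mod_cast (div_left_inj' ht').1 hab

theorem integral_uniformFractions {t : ℕ} (ht : 0 < t) (g : ℝ → ℂ) :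
    ∫ u, g u ∂(uniformFractions t) = (t : ℝ)⁻¹ • ∑ m ∈ Finset.Icc 1 t, g ((m : ℝ) / t) := by
  classical
  set S := (Finset.Icc 1 t).image fun m : ℕ => (m : ℝ) / t with hS
  have hcard : S.card = t := by
    rw [hS, Finset.card_image_of_injective _ (injective_div_natCast ht)]
    simp
  rw [uniformFractions_eq_uniformOn_finset, uniformOn, ProbabilityTheory.cond,
    integral_smul_measure, setIntegral_finset]
  · rw [Measure.count_apply_finset, hcard]
    simp only [Measure.real, Measure.count_singleton, ENNReal.toReal_one, one_smul]
    rw [Finset.sum_image (injective_div_natCast ht).injOn]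
    simp
  · rw [← Set.biUnion_of_singleton (S : Set ℝ), integrableOn_finite_biUnion S.finite_toSet]
    exact fun u _ => integrableOn_singleton
      (hx := by rw [Measure.count_singleton]; exact ENNReal.one_lt_top)

theorem ae_uniformFractions {t : ℕ} (ht : 0 < t) :
    ∀ᵐ u ∂(uniformFractions t), ∃ m ∈ Finset.Icc 1 t, u = (m : ℝ) / t := by
  have hfin : ((fun m : ℕ => (m : ℝ) / (t : ℝ)) '' Set.Icc 1 t).Finite :=
    (Set.finite_Icc 1 t).image _
  have hne : ((fun m : ℕ => (m : ℝ) / (t : ℝ)) '' Set.Icc 1 t).Nonempty :=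
    ⟨_, 1, ⟨le_rfl, ht⟩, rfl⟩
  have := isProbabilityMeasure_uniformOn hfin hne
  have h := uniformOn_self hfin hne
  rw [← uniformFractions] at h this
  filter_upwards [(prob_compl_eq_zero_iff hfin.measurableSet).2 h] with u hu
  obtain ⟨m, hm, rfl⟩ := hu
  exact ⟨m, Finset.mem_Icc.2 hm, rfl⟩

theorem IsCycleFactor.integral_uniformFractions {t : ℕ} (ht : 0 < t) {K : ℝ → ℕ → ℂ}
    (hK : IsCycleFactor t ε K) (x : ℝ) :
    ∫ u, K x (fractionIndex t u) ∂(uniformFractions t) = residueMean t K x := by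
  rw [_root_.integral_uniformFractions ht, residueMean]
  congr 1
  simp only [fractionIndex_div ht]
  rw [← sum_range_add_of_periodic (hK.periodic x) 1]
  obtain ⟨n, rfl⟩ : ∃ n, t = n + 1 := ⟨t - 1, by omega⟩
  rw [sum_Icc_one_eq_sum_range]
  exact Finset.sum_congr rfl fun j _ => by rw [add_comm]

theorem IsCycleFactor.integral_prod_eq [IsProbabilityMeasure P] {t : ℕ} (ht : 0 < t)
    {K : ℝ → ℕ → ℂ} (hK : IsCycleFactor t ε K) {U : ℕ → Ω → ℝ}
    (hL : AEMeasurable (fun ω i => L i ω) P) (hU : ∀ i, HasLaw (U i) (uniformFractions t) P)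
    (hUindep : iIndepFun U P) (hLU : IndepFun (fun ω i => L i ω) (fun ω i => U i ω) P) (N : ℕ) :
    ∫ ω, ∏ i ∈ Finset.range N, K (L i ω) (fractionIndex t (U i ω)) ∂P
      = ∫ ω, ∏ i ∈ Finset.range N, residueMean t K (L i ω) ∂P := by
  have hUm : AEMeasurable (fun ω i => U i ω) P :=
    aemeasurable_pi_lambda _ fun i => (hU i).aemeasurable
  have hKm : Measurable fun p : ℝ × ℕ => K p.1 p.2 :=
    measurable_from_prod_countable_left fun m => (hK.continuous m).measurable
  have hg1 : ∀ i, Measurable fun p : (ℕ → ℝ) × (ℕ → ℝ) => K (p.1 i) (fractionIndex t (p.2 i)) :=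
    fun i => Measurable.comp (f := fun p : (ℕ → ℝ) × (ℕ → ℝ) => (p.1 i, fractionIndex t (p.2 i)))
      hKm
      (((measurable_pi_apply i).comp measurable_fst).prodMk
      ((measurable_fractionIndex t).comp ((measurable_pi_apply i).comp measurable_snd)))
  have hg : Measurable fun p : (ℕ → ℝ) × (ℕ → ℝ) =>
      ∏ i ∈ Finset.range N, K (p.1 i) (fractionIndex t (p.2 i)) :=
    Finset.measurable_fun_prod _ fun i _ => hg1 i
  have hprod := (indepFun_iff_map_prod_eq_prod_map_map hL hUm).1 hLU
  have : IsProbabilityMeasure (P.map fun ω i => L i ω) := Measure.isProbabilityMeasure_map hL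
  have : IsProbabilityMeasure (P.map fun ω i => U i ω) := Measure.isProbabilityMeasure_map hUm
  have h1 : ∫ ω, ∏ i ∈ Finset.range N, K (L i ω) (fractionIndex t (U i ω)) ∂P
      = ∫ p, ∏ i ∈ Finset.range N, K (p.1 i) (fractionIndex t (p.2 i))
        ∂(P.map fun ω => ((fun i => L i ω), fun i => U i ω)) :=
    (integral_map (hL.prodMk hUm) hg.aestronglyMeasurable).symm
  rw [h1, hprod, integral_prod _ (Integrable.of_bound hg.aestronglyMeasurable 1
    (ae_of_all _ fun p => norm_prod_le_one fun _ => hK.norm_le _ _))]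
  have h2 : ∀ l : ℕ → ℝ, ∫ u, ∏ i ∈ Finset.range N, K (l i) (fractionIndex t (u i))
      ∂(P.map fun ω i => U i ω) = ∏ i ∈ Finset.range N, residueMean t K (l i) := by
    intro l
    have hKl : ∀ i, Measurable fun u => K (l i) (fractionIndex t u) := fun i =>
      hKm.comp (measurable_const.prodMk (measurable_fractionIndex t))
    rw [integral_map hUm]
    · simp only [Finset.prod_range]
      rw [(hUindep.precomp Fin.val_injective).integral_fun_prod_comp
        (f := fun (i : Fin N) u => K (l i) (fractionIndex t u))
        (fun i => (hU i).aemeasurable) (fun i => (hKl i).aestronglyMeasurable)]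
      refine Finset.prod_congr rfl fun i _ => ?_
      rw [← hK.integral_uniformFractions ht]
      exact (hU i).integral_comp (hKl i).aestronglyMeasurable
    · exact (Finset.measurable_fun_prod _ fun i _ =>
        (hKl i).comp (measurable_pi_apply i)).aestronglyMeasurable
  simp only [h2]
  have hm : Measurable fun l : ℕ → ℝ => ∏ i ∈ Finset.range N, residueMean t K (l i) :=
    Finset.measurable_fun_prod _ fun i _ =>
      hK.continuous_residueMean.measurable.comp (measurable_pi_apply i)
  exact integral_map hL hm.aestronglyMeasurable

end LimitFunctional

/-! ### Convergence in distribution of additive functionals -/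

/-- The representative in `{0, …, t - 1}` of `-s ℓ` modulo `t`. -/
def residueIndex (s : ℤ) (t ℓ : ℕ) : ℕ := ((-(s * ℓ)) % (t : ℤ)).toNat

section ResidueIndex

variable {s : ℤ} {t : ℕ}

theorem natCast_residueIndex (s : ℤ) (ht : 0 < t) (ℓ : ℕ) :
    (residueIndex s t ℓ : ℤ) = (-(s * ℓ)) % (t : ℤ) :=
  Int.toNat_of_nonneg (Int.emod_nonneg _ (by omega))

theorem residueIndex_lt (s : ℤ) (ht : 0 < t) (ℓ : ℕ) : residueIndex s t ℓ < t := by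
  have h := natCast_residueIndex s ht ℓ
  have h2 := Int.emod_lt_of_pos (-(s * ℓ)) (b := (t : ℤ)) (by omega)
  omega

theorem periodic_residueIndex (s : ℤ) (t : ℕ) :
    Function.Periodic (residueIndex s t) t := fun ℓ => by
  rw [residueIndex, residueIndex]
  congr 1
  rw [Int.emod_emod_of_dvd _ (dvd_refl _) |>.symm, Nat.cast_add,
    show -(s * ((ℓ : ℤ) + t)) = -(s * ℓ) + t * (-s) by ring, Int.add_mul_emod_self_left]
  simp

theorem image_residueIndex (ht : 0 < t) (hst : IsCoprime s (t : ℤ)) :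
    (Finset.range t).image (residueIndex s t) = Finset.range t := by
  have hinj : Set.InjOn (residueIndex s t) (Finset.range t : Set ℕ) := by
    intro a ha b hb hab
    have h1 : (-(s * a)) % (t : ℤ) = (-(s * b)) % (t : ℤ) := by
      rw [← natCast_residueIndex s ht, ← natCast_residueIndex s ht, hab]
    have h2 : (t : ℤ) ∣ s * ((b : ℤ) - a) := by
      rw [Int.emod_eq_emod_iff_emod_sub_eq_zero, ← Int.dvd_iff_emod_eq_zero] at h1
      exact h1.trans (dvd_of_eq (by ring))
    exact (Nat.modEq_iff_dvd.2 (hst.symm.dvd_of_dvd_mul_left h2)).eq_of_lt_of_lt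
      (Finset.mem_range.1 ha) (Finset.mem_range.1 hb)
  refine Finset.eq_of_subset_of_card_le (fun r hr => ?_) (by rw [Finset.card_image_of_injOn hinj])
  obtain ⟨ℓ, -, rfl⟩ := Finset.mem_image.1 hr
  exact Finset.mem_range.2 (residueIndex_lt s ht ℓ)

theorem residueIndex_eq_zero_iff (ht : 0 < t) (hst : IsCoprime s (t : ℤ)) (ℓ : ℕ) :
    residueIndex s t ℓ = 0 ↔ t ∣ ℓ := by
  have h := natCast_residueIndex s ht ℓ
  have h1 : residueIndex s t ℓ = 0 ↔ (t : ℤ) ∣ s * ℓ := by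
    rw [← Int.natCast_eq_zero, h, ← Int.dvd_iff_emod_eq_zero, Int.dvd_neg]
  rw [h1, ← Int.natCast_dvd_natCast]
  exact ⟨fun h => hst.symm.dvd_of_dvd_mul_left h, fun h => dvd_mul_of_dvd_right h s⟩

theorem sum_residueIndex {M : Type*} [AddCommMonoid M] (ht : 0 < t) (hst : IsCoprime s (t : ℤ))
    (g : ℕ → M) : ∑ ℓ ∈ Finset.range t, g (residueIndex s t ℓ) = ∑ r ∈ Finset.range t, g r := by
  conv_rhs => rw [← image_residueIndex ht hst]
  rw [Finset.sum_image]
  exact Finset.card_image_iff.1 (by rw [image_residueIndex ht hst])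

theorem IsCycleFactor.comp_residueIndex {ε : ℝ} {K : ℝ → ℕ → ℂ} (hK : IsCycleFactor t ε K) (s : ℤ) :
    IsCycleFactor t ε fun x ℓ => K x (residueIndex s t ℓ) where
  periodic x ℓ := by simp only [periodic_residueIndex s t ℓ]
  continuous r := hK.continuous _
  norm_le x r := hK.norm_le _ _
  eq_one x hx r := hK.eq_one x hx _

theorem residueMean_comp_residueIndex (ht : 0 < t) (hst : IsCoprime s (t : ℤ)) (K : ℝ → ℕ → ℂ) :
    residueMean t (fun x ℓ => K x (residueIndex s t ℓ)) = residueMean t K := by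
  funext x
  rw [residueMean, residueMean, sum_residueIndex ht hst (K x)]

end ResidueIndex

/-- The expectation of a product over the cycles of an Ewens permutation converges to that of the
product over a stick sequence of the means of the factor over residue classes. -/
theorem tendsto_integral_ewens_prod {θ ε : ℝ} (hθ : 0 < θ) (hε : 0 < ε) {s : ℤ} {t : ℕ}
    (ht : 0 < t) (hst : IsCoprime s (t : ℤ)) {K : ℝ → ℕ → ℂ} (hK : IsCycleFactor t ε K) :
    Tendsto (fun n : ℕ => ∫ σ : Equiv.Perm (Fin n),
      (σ.partition.parts.map fun ℓ : ℕ => K ((ℓ : ℝ) / n) (residueIndex s t ℓ)).prod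
        ∂(ewens θ hθ n).toMeasure) atTop (nhds (gemProduct θ (residueMean t K))) := by
  have h := tendsto_ewensProduct hθ hε ht (hK.comp_residueIndex s)
    (c := gemProduct θ (residueMean t K)) (by
      rw [residueMean_comp_residueIndex ht hst]
      exact tendsto_stickIterate_one hθ hε hK.continuous_residueMean hK.norm_residueMean_le
        fun x hx => hK.residueMean_eq_one ht hx)
  exact h.congr fun n => (integral_ewens_prod hθ _ n).symm

/-- Summands `G x m`, for a cycle of relative size `x` and residue index `m` modulo `t`, that depend
continuously on the relative size and ignore cycles of relative size at most `ε`. -/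
structure IsCycleSummand (t : ℕ) (ε : ℝ) (G : ℝ → ℕ → ℝ) : Prop where
  periodic : ∀ x, Function.Periodic (G x) t
  continuous : ∀ r, Continuous fun x => G x r
  eq_zero : ∀ x ≤ ε, ∀ r, G x r = 0

theorem IsCycleSummand.isCycleFactor_exp {t : ℕ} {ε : ℝ} {G : ℝ → ℕ → ℝ}
    (hG : IsCycleSummand t ε G) (ξ : ℝ) :
    IsCycleFactor t ε fun x m => Complex.exp (ξ * G x m * Complex.I) where
  periodic x m := by simp only [hG.periodic x m]
  continuous r := by
    have := hG.continuous r
    fun_prop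
  norm_le x m := by
    rw [← Complex.ofReal_mul, Complex.norm_exp_ofReal_mul_I]
  eq_one x hx m := by simp [hG.eq_zero x hx m]

section AdditiveFunctional

variable {θ ε : ℝ} {s : ℤ} {t : ℕ} {G : ℝ → ℕ → ℝ}
  {Ω : Type*} [MeasurableSpace Ω] {P : Measure Ω} {L U : ℕ → Ω → ℝ}

theorem IsCycleSummand.exists_forall_eq_zero (hG : IsCycleSummand t ε G) (hθ : 0 < θ) (hε : 0 < ε)
    (hL : HasLaw (fun ω i => L i ω) (poissonDirichlet θ) P) :
    ∀ᵐ ω ∂P, ∃ N, ∀ i ∉ Finset.range N, ∀ m, G (L i ω) m = 0 := by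
  filter_upwards [ae_poissonDirichlet hθ hε hL] with ω hω
  obtain ⟨-, N, hN⟩ := hω
  exact ⟨N, fun i hi m => hG.eq_zero _ (hN i (by simpa using hi)) m⟩

theorem IsCycleSummand.aemeasurable_apply (hG : IsCycleSummand t ε G)
    (hL : AEMeasurable (fun ω i => L i ω) P) (hU : ∀ i, HasLaw (U i) (uniformFractions t) P)
    (i : ℕ) : AEMeasurable (fun ω => G (L i ω) (fractionIndex t (U i ω))) P := by
  have hGm : Measurable fun p : ℝ × ℕ => G p.1 p.2 :=
    measurable_from_prod_countable_left fun m => (hG.continuous m).measurable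
  exact hGm.comp_aemeasurable (((measurable_pi_apply i).comp_aemeasurable hL).prodMk
    ((measurable_fractionIndex t).comp_aemeasurable (hU i).aemeasurable))

theorem IsCycleSummand.ae_tendsto_sum (hG : IsCycleSummand t ε G) (hθ : 0 < θ) (hε : 0 < ε)
    (hL : HasLaw (fun ω i => L i ω) (poissonDirichlet θ) P) :
    ∀ᵐ ω ∂P, Tendsto (fun N => ∑ i ∈ Finset.range N, G (L i ω) (fractionIndex t (U i ω))) atTop
      (nhds (∑' i, G (L i ω) (fractionIndex t (U i ω)))) := by
  filter_upwards [hG.exists_forall_eq_zero hθ hε hL] with ω hω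
  obtain ⟨N, hN⟩ := hω
  exact (summable_of_ne_finset_zero fun i hi => hN i hi _).hasSum.tendsto_sum_nat

theorem IsCycleSummand.aemeasurable_tsum (hG : IsCycleSummand t ε G) (hθ : 0 < θ) (hε : 0 < ε)
    (hL : HasLaw (fun ω i => L i ω) (poissonDirichlet θ) P)
    (hU : ∀ i, HasLaw (U i) (uniformFractions t) P) :
    AEMeasurable (fun ω => ∑' i, G (L i ω) (fractionIndex t (U i ω))) P :=
  aemeasurable_of_tendsto_metrizable_ae'
    (fun N => Finset.aemeasurable_fun_sum (Finset.range N) fun i _ =>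
    hG.aemeasurable_apply hL.aemeasurable hU i) (hG.ae_tendsto_sum hθ hε hL)

theorem IsCycleSummand.integral_exp_tsum [IsProbabilityMeasure P] (hG : IsCycleSummand t ε G)
    (hθ : 0 < θ) (hε : 0 < ε) (ht : 0 < t)
    (hL : HasLaw (fun ω i => L i ω) (poissonDirichlet θ) P)
    (hU : ∀ i, HasLaw (U i) (uniformFractions t) P) (hUindep : iIndepFun U P)
    (hLU : IndepFun (fun ω i => L i ω) (fun ω i => U i ω) P) (ξ : ℝ) :
    ∫ ω, Complex.exp (ξ * (∑' i, G (L i ω) (fractionIndex t (U i ω)) : ℝ) * Complex.I) ∂P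
      = gemProduct θ (residueMean t fun x m => Complex.exp (ξ * G x m * Complex.I)) := by
  have hK := hG.isCycleFactor_exp ξ
  have h1 := tendsto_integral_prod_poissonDirichlet hθ hε hK.continuous_residueMean
    hK.norm_residueMean_le (fun x hx => hK.residueMean_eq_one ht hx) hL
  simp only [← hK.integral_prod_eq ht hL.aemeasurable hU hUindep hLU, ← Complex.exp_sum] at h1
  refine tendsto_nhds_unique (tendsto_integral_of_dominated_convergence (fun _ => 1) (fun N => ?_)
    (integrable_const _) (fun N => ae_of_all _ fun ω => ?_) ?_) h1
  · refine AEMeasurable.aestronglyMeasurable ?_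
    refine Complex.measurable_exp.comp_aemeasurable (Finset.aemeasurable_fun_sum _ fun i _ => ?_)
    exact ((Complex.measurable_ofReal.comp_aemeasurable
      (hG.aemeasurable_apply hL.aemeasurable hU i)).const_mul _).mul_const _
  · rw [← Finset.sum_mul, ← Finset.mul_sum, ← Complex.ofReal_sum, ← Complex.ofReal_mul,
      Complex.norm_exp_ofReal_mul_I]
  · filter_upwards [hG.ae_tendsto_sum (U := U) hθ hε hL] with ω hω
    have hc : Continuous fun y : ℝ => Complex.exp (ξ * y * Complex.I) := by fun_prop
    refine ((hc.tendsto _).comp hω).congr fun N => ?_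
    simp only [Function.comp_apply]
    rw [← Finset.sum_mul, ← Finset.mul_sum, ← Complex.ofReal_sum]

theorem tendstoInDistribution_cycle_sum [IsProbabilityMeasure P] (hG : IsCycleSummand t ε G)
    (hθ : 0 < θ) (hε : 0 < ε) (ht : 0 < t) (hst : IsCoprime s (t : ℤ))
    (hL : HasLaw (fun ω i => L i ω) (poissonDirichlet θ) P)
    (hU : ∀ i, HasLaw (U i) (uniformFractions t) P) (hUindep : iIndepFun U P)
    (hLU : IndepFun (fun ω i => L i ω) (fun ω i => U i ω) P) :
    TendstoInDistribution (fun (n : ℕ) (σ : Equiv.Perm (Fin n)) =>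
        (σ.partition.parts.map fun ℓ : ℕ => G ((ℓ : ℝ) / n) (residueIndex s t ℓ)).sum) atTop
      (fun ω => ∑' i, G (L i ω) (fractionIndex t (U i ω)))
      (fun n => (ewens θ hθ n).toMeasure) P where
  forall_aemeasurable n := (measurable_from_top).aemeasurable
  aemeasurable_limit := hG.aemeasurable_tsum hθ hε hL hU
  tendsto := by
    refine ProbabilityMeasure.tendsto_iff_tendsto_charFun.2 fun ξ => ?_
    have hc : Continuous fun y : ℝ => Complex.exp (ξ * y * Complex.I) := by fun_prop
    simp only [ProbabilityMeasure.coe_mk, charFun_apply_real]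
    rw [integral_map (hG.aemeasurable_tsum hθ hε hL hU) hc.aestronglyMeasurable,
      hG.integral_exp_tsum hθ hε ht hL hU hUindep hLU ξ]
    refine (tendsto_integral_ewens_prod hθ hε ht hst (hG.isCycleFactor_exp ξ)).congr fun n => ?_
    rw [integral_map measurable_from_top.aemeasurable hc.aestronglyMeasurable]
    refine integral_congr_ae (ae_of_all _ fun σ => ?_)
    simp only
    rw [← Function.comp_def Complex.exp, ← Multiset.map_map, ← Complex.exp_multiset_sum,
      Multiset.sum_map_mul_right, Multiset.sum_map_mul_left]
    congr 3
    rw [← Complex.ofRealHom_eq_coe, map_multiset_sum, Multiset.map_map]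
    rfl

end AdditiveFunctional

/-! ### Integrals against the point processes -/

/-- The sum of `g` over the points `(m / t + q) / x`, `q ∈ ℤ`, that a cycle of relative size `x` and
residue index `m` contributes. The cutoff at `ε` only matters for cycles too small to have a nonzero
point in the support of `g`; it makes the sum continuous in `x` down to `0`. -/
noncomputable def cyclePointSum (g : ℝ → ℝ) (t : ℕ) (ε x : ℝ) (m : ℕ) : ℝ :=
  ∑' q : ℤ, g (((m : ℝ) / t + q) / max x ε)

section CyclePointSum

variable {g : ℝ → ℝ} {t : ℕ} {A : ℝ}

theorem finite_ne_zero_of_forall_le_abs (hA : ∀ x, A ≤ |x| → g x = 0) (a : ℝ) {y : ℝ} (hy : 0 < y) :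
    {q : ℤ | g ((a + q) / y) ≠ 0}.Finite := by
  refine (Set.finite_Icc ⌊-(A * y) - a⌋ ⌈A * y - a⌉).subset fun q hq => ?_
  have h1 : |(a + q) / y| < A := not_le.1 fun h => hq (hA _ h)
  rw [abs_div, abs_of_pos hy, div_lt_iff₀ hy, abs_lt] at h1
  constructor
  · exact_mod_cast (Int.floor_le _).trans (show -(A * y) - a ≤ (q : ℝ) by linarith [h1.1])
  · exact_mod_cast (show (q : ℝ) ≤ A * y - a by linarith [h1.2]).trans (Int.le_ceil _)

theorem summable_of_forall_le_abs (hA : ∀ x, A ≤ |x| → g x = 0) (a : ℝ) {y : ℝ} (hy : 0 < y) :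
    Summable fun q : ℤ => g ((a + q) / y) :=
  summable_of_hasFiniteSupport (finite_ne_zero_of_forall_le_abs hA a hy)

/-- Nonzero points of a cycle of relative size `y` have absolute value at least `1 / (t y)`. -/
theorem apply_div_eq_zero (ht : 0 < t) (hA0 : 0 < A) (hA : ∀ x, A ≤ |x| → g x = 0) (h0 : g 0 = 0)
    {y : ℝ} (hy0 : 0 ≤ y) (hy : y ≤ 1 / (t * A)) (m : ℕ) (q : ℤ) :
    g (((m : ℝ) / t + q) / y) = 0 := by
  have ht' : (0 : ℝ) < t := by exact_mod_cast ht
  rcases eq_or_ne ((m : ℤ) + q * t) 0 with h | h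
  · have : (m : ℝ) / t + q = 0 := by
      have h' : (m : ℝ) + q * t = 0 := by exact_mod_cast h
      field_simp
      linarith
    rw [this, zero_div, h0]
  rcases hy0.eq_or_lt with rfl | hy0
  · rw [div_zero, h0]
  refine hA _ ?_
  have h1 : (1 : ℝ) ≤ |(m : ℝ) + q * t| := by exact_mod_cast Int.one_le_abs h
  have e : ((m : ℝ) / t + q) / y = ((m : ℝ) + q * t) / (t * y) := by field_simp
  rw [e, abs_div, abs_of_pos (by positivity : (0 : ℝ) < t * y), le_div_iff₀ (by positivity)]
  refine le_trans ?_ h1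
  rw [le_div_iff₀ (by positivity)] at hy
  linarith

theorem isCycleSummand_cyclePointSum (hg : Continuous g) (ht : 0 < t) (hA0 : 0 < A)
    (hA : ∀ x, A ≤ |x| → g x = 0) (h0 : g 0 = 0) :
    IsCycleSummand t (1 / (t * A)) (cyclePointSum g t (1 / (t * A))) := by
  have ht' : (0 : ℝ) < t := by exact_mod_cast ht
  have hε : 0 < 1 / (t * A) := by positivity
  set ε := 1 / (t * A) with hεdef
  refine ⟨fun x m => ?_, fun m => ?_, fun x hx m => ?_⟩
  · rw [cyclePointSum, cyclePointSum, ← (Equiv.addRight (1 : ℤ)).tsum_eq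
      (fun q : ℤ => g (((m : ℝ) / t + q) / max x ε))]
    refine tsum_congr fun q => ?_
    congr 2
    simp only [Equiv.coe_addRight]
    push_cast
    field_simp
    ring
  · rw [continuous_iff_continuousAt]
    intro x₀
    -- near `x₀` the sum has its nonzero terms in a fixed finite set
    set R := max (x₀ + 1) ε with hR
    have hR0 : 0 < R := lt_max_of_lt_right hε
    set S := Finset.Icc ⌊-(A * R) - (m : ℝ) / t⌋ ⌈A * R - (m : ℝ) / t⌉ with hS
    have hcont : Continuous fun x => ∑ q ∈ S, g (((m : ℝ) / t + q) / max x ε) := by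
      refine continuous_finsetSum _ fun q _ => hg.comp (Continuous.div continuous_const
        (by fun_prop) fun x => (lt_max_of_lt_right hε).ne')
    refine hcont.continuousAt.congr ?_
    filter_upwards [Iio_mem_nhds (lt_add_one x₀)] with x hx
    refine (tsum_eq_sum fun q hq => hA _ ?_).symm
    by_contra hlt
    have hy : 0 < max x ε := lt_max_of_lt_right hε
    rw [not_le, abs_div, abs_of_pos hy, div_lt_iff₀ hy, abs_lt] at hlt
    have hle : A * max x ε ≤ A * R :=
      mul_le_mul_of_nonneg_left (max_le_max (le_of_lt hx) le_rfl) hA0.le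
    refine hq (Finset.mem_Icc.2 ⟨?_, ?_⟩)
    · exact_mod_cast (Int.floor_le _).trans
        (show -(A * R) - (m : ℝ) / t ≤ (q : ℝ) by linarith [hlt.1])
    · exact_mod_cast (show (q : ℝ) ≤ A * R - (m : ℝ) / t by linarith [hlt.2]).trans (Int.le_ceil _)
  · rw [cyclePointSum, max_eq_right hx]
    refine (tsum_congr fun q => ?_).trans tsum_zero
    exact apply_div_eq_zero ht hA0 hA h0 hε.le le_rfl m q

theorem cyclePointSum_nonneg (hg0 : ∀ x, 0 ≤ g x) (t : ℕ) (ε x : ℝ) (m : ℕ) :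
    0 ≤ cyclePointSum g t ε x m := tsum_nonneg fun _ => hg0 _

theorem tsum_ofReal_eq_cyclePointSum (ht : 0 < t) (hA0 : 0 < A) (hA : ∀ x, A ≤ |x| → g x = 0)
    (h0 : g 0 = 0) (hg0 : ∀ x, 0 ≤ g x) {x : ℝ} (hx : 0 ≤ x) (m : ℕ) :
    ∑' q : ℤ, ENNReal.ofReal (g (((m : ℝ) / t + q) / x))
      = ENNReal.ofReal (cyclePointSum g t (1 / (t * A)) x m) := by
  have ht' : (0 : ℝ) < t := by exact_mod_cast ht
  have hε : 0 < 1 / (t * A) := by positivity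
  rw [cyclePointSum]
  rcases le_or_gt x (1 / (t * A)) with h | h
  · rw [max_eq_right h]
    have h1 : ∀ q : ℤ, g (((m : ℝ) / t + q) / x) = 0 := fun q => by
      exact apply_div_eq_zero ht hA0 hA h0 hx h m q
    have h2 : ∀ q : ℤ, g (((m : ℝ) / t + q) / (1 / (t * A))) = 0 := fun q => by
      exact apply_div_eq_zero ht hA0 hA h0 hε.le le_rfl m q
    simp only [h1, h2]
    simp
  · rw [max_eq_left h.le, ENNReal.ofReal_tsum_of_nonneg (fun _ => hg0 _)
      (summable_of_forall_le_abs hA _ (hε.trans h))]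

end CyclePointSum

theorem lintegral_limitProcess (l u : ℕ → ℝ) (h : ℝ → ℝ≥0∞) :
    ∫⁻ x, h x ∂(limitProcess l u) = ∑' i, ∑' q : ℤ, h ((u i + q) / l i) := by
  simp [limitProcess, lintegral_sum_measure, lintegral_dirac]

theorem lintegral_eigenProcess (α : ℝ) {n : ℕ} (σ : Equiv.Perm (Fin n)) (h : ℝ → ℝ≥0∞) :
    ∫⁻ x, h x ∂(eigenProcess α n σ)
      = ∑ j ∈ Finset.Icc 1 n, (cycleCount j σ : ℝ≥0∞) *
        ∑' i : ℤ, h ((n : ℝ) * ((i : ℝ) / (j : ℝ) - α)) := by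
  rw [eigenProcess, lintegral_finsetSum_measure]
  refine Finset.sum_congr rfl fun j _ => ?_
  rw [← Nat.cast_smul_eq_nsmul ℝ≥0∞, lintegral_smul_measure, lintegral_sum_measure]
  simp [lintegral_dirac]

theorem parts_subset_Icc {n : ℕ} (σ : Equiv.Perm (Fin n)) :
    σ.partition.parts.toFinset ⊆ Finset.Icc 1 n := fun j hj => by
  obtain ⟨hpos, hsum⟩ := mem_partitionMultisets.1 (parts_partition_mem σ)
  rw [Multiset.mem_toFinset] at hj
  exact Finset.mem_Icc.2 ⟨hpos j hj, hsum ▸ Multiset.le_sum_of_mem hj⟩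

theorem sum_map_parts {M : Type*} [AddCommMonoid M] {n : ℕ} (σ : Equiv.Perm (Fin n)) (h : ℕ → M) :
    (σ.partition.parts.map h).sum = ∑ j ∈ Finset.Icc 1 n, cycleCount j σ • h j := by
  rw [Finset.sum_multiset_map_count]
  refine Finset.sum_subset (parts_subset_Icc σ) fun j _ hj => ?_
  rw [Multiset.mem_toFinset] at hj
  simp [Multiset.count_eq_zero_of_notMem hj]

/-- The points of a cycle of length `j`, in terms of the residue index of `j`. -/
theorem tsum_eigenangles (s : ℤ) {t : ℕ} (ht : 0 < t) {n j : ℕ} (hj : 0 < j) (h : ℝ → ℝ≥0∞) :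
    ∑' i : ℤ, h ((n : ℝ) * ((i : ℝ) / j - (s : ℝ) / t))
      = ∑' q : ℤ, h (((residueIndex s t j : ℝ) / t + q) / ((j : ℝ) / n)) := by
  have ht' : (t : ℝ) ≠ 0 := by exact_mod_cast ht.ne'
  have hj' : (j : ℝ) ≠ 0 := by exact_mod_cast hj.ne'
  set k := (-(s * j)) / (t : ℤ) with hk
  have h1 : (residueIndex s t j : ℤ) + t * k = -(s * j) := by
    rw [natCast_residueIndex s ht, hk]; exact Int.emod_add_mul_ediv _ _
  have h2 : (residueIndex s t j : ℝ) + t * k = -(s * j) := by exact_mod_cast h1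
  rw [← (Equiv.addRight k).tsum_eq
    (fun q : ℤ => h (((residueIndex s t j : ℝ) / t + q) / ((j : ℝ) / n)))]
  refine tsum_congr fun i => ?_
  congr 1
  have h3 : (residueIndex s t j : ℝ) / t + ((i + k : ℤ) : ℝ) = i - s * j / t := by
    push_cast
    field_simp
    linear_combination h2
  simp only [Equiv.coe_addRight]
  rw [h3, div_div_eq_mul_div]
  field_simp

theorem exists_pos_forall_le_abs {f : ℝ → ℝ} (hfc : HasCompactSupport f) :
    ∃ A > 0, ∀ x, A ≤ |x| → f x = 0 := by
  obtain ⟨A, hA⟩ := hfc.isCompact.isBounded.exists_norm_le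
  refine ⟨max A 0 + 1, by positivity, fun x hx => ?_⟩
  by_contra hne
  have := hA x (subset_tsupport f hne)
  rw [Real.norm_eq_abs] at this
  linarith [le_max_left A 0]

theorem integrable_eigenProcess {f : ℝ → ℝ} (hf : Continuous f) (hfc : HasCompactSupport f) (s : ℤ)
    {t : ℕ} (ht : 0 < t) (n : ℕ) (σ : Equiv.Perm (Fin n)) :
    Integrable f (eigenProcess ((s : ℝ) / t) n σ) := by
  obtain ⟨A, -, hA⟩ := exists_pos_forall_le_abs hfc
  refine ⟨hf.aestronglyMeasurable, ?_⟩
  rw [HasFiniteIntegral, lintegral_eigenProcess]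
  refine ENNReal.sum_lt_top.2 fun j hj => ENNReal.mul_lt_top (ENNReal.natCast_lt_top _) ?_
  obtain ⟨hj1, hjn⟩ := Finset.mem_Icc.1 hj
  have hj0 : (0 : ℝ) < j := by exact_mod_cast hj1
  have hn0 : (0 : ℝ) < n := by exact_mod_cast (lt_of_lt_of_le hj1 hjn)
  rw [tsum_eigenangles s ht hj1 (fun x => ‖f x‖ₑ)]
  have hfin := finite_ne_zero_of_forall_le_abs hA ((residueIndex s t j : ℝ) / t)
    (div_pos hj0 hn0)
  rw [tsum_eq_sum (s := hfin.toFinset) fun q hq => by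
    have : f (((residueIndex s t j : ℝ) / t + q) / ((j : ℝ) / n)) = 0 := by simpa using hq
    rw [this, enorm_zero]]
  exact ENNReal.sum_lt_top.2 fun q _ => enorm_lt_top

section NonnegTestFunction

variable {g : ℝ → ℝ} {t : ℕ} {A : ℝ}

theorem lintegral_eigenProcess_ofReal (s : ℤ) (ht : 0 < t) (hA0 : 0 < A)
    (hA : ∀ x, A ≤ |x| → g x = 0) (h0 : g 0 = 0) (hg0 : ∀ x, 0 ≤ g x) {n : ℕ}
    (σ : Equiv.Perm (Fin n)) :
    ∫⁻ x, ENNReal.ofReal (g x) ∂(eigenProcess ((s : ℝ) / t) n σ)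
      = ENNReal.ofReal (σ.partition.parts.map fun ℓ : ℕ =>
          cyclePointSum g t (1 / (t * A)) ((ℓ : ℝ) / n) (residueIndex s t ℓ)).sum := by
  have hW := fun x m => cyclePointSum_nonneg hg0 t (1 / (t * A)) x m
  rw [lintegral_eigenProcess, sum_map_parts, ENNReal.ofReal_sum_of_nonneg fun j _ =>
    nsmul_nonneg (hW _ _) _]
  refine Finset.sum_congr rfl fun j hj => ?_
  rw [tsum_eigenangles s ht (Finset.mem_Icc.1 hj).1 (fun x => ENNReal.ofReal (g x)),
    tsum_ofReal_eq_cyclePointSum ht hA0 hA h0 hg0 (by positivity), ENNReal.ofReal_nsmul,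
    nsmul_eq_mul]

theorem lintegral_limitProcess_ofReal (ht : 0 < t) (hA0 : 0 < A) (hA : ∀ x, A ≤ |x| → g x = 0)
    (h0 : g 0 = 0) (hg0 : ∀ x, 0 ≤ g x) {l u : ℕ → ℝ} (hl : ∀ i, 0 ≤ l i)
    (hu : ∀ i, ∃ m ∈ Finset.Icc 1 t, u i = (m : ℝ) / t)
    (hs : Summable fun i => cyclePointSum g t (1 / (t * A)) (l i) (fractionIndex t (u i))) :
    ∫⁻ x, ENNReal.ofReal (g x) ∂(limitProcess l u)
      = ENNReal.ofReal (∑' i, cyclePointSum g t (1 / (t * A)) (l i) (fractionIndex t (u i))) := by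
  rw [lintegral_limitProcess, ENNReal.ofReal_tsum_of_nonneg
    (fun i => cyclePointSum_nonneg hg0 t _ _ _) hs]
  refine tsum_congr fun i => ?_
  obtain ⟨m, -, hm⟩ := hu i
  rw [hm, tsum_ofReal_eq_cyclePointSum ht hA0 hA h0 hg0 (hl i), fractionIndex_div ht]

end NonnegTestFunction

/-! ### Cycles of length divisible by `t` -/

/-- The number of cycles of `σ` of length divisible by `t`. -/
def divisibleCount (t : ℕ) {n : ℕ} (σ : Equiv.Perm (Fin n)) : ℕ :=
  (σ.partition.parts.map fun ℓ => if t ∣ ℓ then 1 else 0).sum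

/-- The continuous function that is `0` up to `δ`, is `1` from `2 δ` on, and is affine between. -/
noncomputable def ramp (δ x : ℝ) : ℝ := min 1 (max 0 ((x - δ) / δ))

theorem ramp_nonneg (δ x : ℝ) : 0 ≤ ramp δ x := le_min zero_le_one (le_max_left _ _)

theorem ramp_le_one (δ x : ℝ) : ramp δ x ≤ 1 := min_le_left _ _

theorem ramp_eq_zero {δ x : ℝ} (hδ : 0 < δ) (hx : x ≤ δ) : ramp δ x = 0 := by
  rw [ramp, max_eq_left (div_nonpos_of_nonpos_of_nonneg (by linarith) hδ.le),
    min_eq_right zero_le_one]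

theorem ramp_eq_one {δ x : ℝ} (hδ : 0 < δ) (hx : 2 * δ ≤ x) : ramp δ x = 1 := by
  have h : 1 ≤ (x - δ) / δ := by rw [le_div_iff₀ hδ]; linarith
  rw [ramp, max_eq_right (zero_le_one.trans h), min_eq_left h]

theorem continuous_ramp (δ : ℝ) : Continuous (ramp δ) := by
  unfold ramp
  fun_prop

/-- The factor `1 / 2` for cycles of relative size at least `2 δ` and residue index divisible by
`t`, and `1` for cycles of relative size at most `δ` or of other residue indices; `ramp` interpolates
continuously in between. -/
noncomputable def divisibleFactor (t : ℕ) (δ x : ℝ) (m : ℕ) : ℝ :=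
  1 - if t ∣ m then ramp δ x / 2 else 0

theorem divisibleFactor_mem (t : ℕ) (δ x : ℝ) (m : ℕ) :
    divisibleFactor t δ x m ∈ Set.Icc (1 / 2 : ℝ) 1 := by
  have h0 := ramp_nonneg δ x
  have h1 := ramp_le_one δ x
  unfold divisibleFactor
  split_ifs
  · constructor <;> linarith
  · norm_num

theorem isCycleFactor_divisibleFactor (t : ℕ) {δ : ℝ} (hδ : 0 < δ) :
    IsCycleFactor t δ fun x m => (divisibleFactor t δ x m : ℂ) where
  periodic x m := by simp [divisibleFactor]
  continuous m := by
    have := continuous_ramp δ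
    unfold divisibleFactor
    split_ifs <;> fun_prop
  norm_le x m := by
    have h := divisibleFactor_mem t δ x m
    rw [Complex.norm_of_nonneg (by linarith [h.1])]
    exact h.2
  eq_one x hx m := by simp [divisibleFactor, ramp_eq_zero hδ hx]

theorem residueMean_divisibleFactor {t : ℕ} (ht : 0 < t) (δ x : ℝ) :
    residueMean t (fun x m => (divisibleFactor t δ x m : ℂ)) x
      = ((1 - ramp δ x / (2 * t) : ℝ) : ℂ) := by
  have ht' : (t : ℝ) ≠ 0 := by exact_mod_cast ht.ne'
  have hsum : ∑ r ∈ Finset.range t, divisibleFactor t δ x r = t - ramp δ x / 2 := by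
    simp only [divisibleFactor, Finset.sum_sub_distrib, Finset.sum_const, Finset.card_range,
      nsmul_eq_mul, mul_one]
    rw [Finset.sum_eq_single 0]
    · simp
    · intro r hr hr0
      rw [if_neg fun h => hr0 (Nat.eq_zero_of_dvd_of_lt h (Finset.mem_range.1 hr))]
    · intro h
      exact absurd (Finset.mem_range.2 ht) h
  simp only [residueMean]
  rw [← Complex.ofReal_sum, hsum, Complex.real_smul, ← Complex.ofReal_mul]
  congr 1
  field_simp

theorem norm_finprod_le_prod_range {l : ℕ → ℂ} {S : Finset ℕ} (h1 : ∀ i, ‖l i‖ ≤ 1)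
    (h : ∀ i, i ∉ S → l i = 1) (M : ℕ) : ‖∏ᶠ i, l i‖ ≤ ‖∏ i ∈ Finset.range M, l i‖ := by
  refine le_of_tendsto (tendsto_prod_range_finprod h).norm ?_
  filter_upwards [eventually_ge_atTop M] with N hN
  rw [← Finset.prod_range_mul_prod_Ico _ hN, norm_mul]
  exact mul_le_of_le_one_right (norm_nonneg _) (norm_prod_le_one h1)

/-- A stick sequence has infinitely many terms, so as the cutoff tends to zero more and more of them
contribute a factor of modulus at most `r < 1`. -/
theorem tendsto_gemProduct_zero {θ : ℝ} (hθ : 0 < θ) {φ : ℕ → ℝ → ℂ} {r : ℝ} (hr1 : r < 1)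
    (hφc : ∀ k, Continuous (φ k)) (hφ : ∀ k x, ‖φ k x‖ ≤ 1)
    (hφ1 : ∀ k : ℕ, ∀ x ≤ 1 / ((k : ℝ) + 1), φ k x = 1)
    (hφr : ∀ k : ℕ, ∀ x, 2 * (1 / ((k : ℝ) + 1)) ≤ x → ‖φ k x‖ ≤ r) :
    Tendsto (fun k => gemProduct θ (φ k)) atTop (nhds 0) := by
  have := isProbabilityMeasure_beta_one hθ
  have hδ : ∀ k : ℕ, 0 < 1 / ((k : ℝ) + 1) := fun k => by positivity
  have hr0 : 0 ≤ r := (norm_nonneg _).trans (hφr 0 _ le_rfl)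
  have hfac : ∀ k, ∀ v, IsStickSequence v → ∃ S : Finset ℕ, ∀ i, i ∉ S → φ k (v i) = 1 :=
    fun k v hv => ⟨(hv.finite_lt (hδ k)).toFinset, fun i hi => hφ1 k _ (by simpa using hi)⟩
  have hlim := tendsto_integral_of_dominated_convergence
    (μ := Measure.infinitePi fun _ : ℕ => betaMeasure 1 θ)
    (F := fun k w => ∏ᶠ i, φ k (stickBreaking w i)) (f := fun _ => 0) (fun _ => 1) ?_
    (integrable_const _) ?_ ?_
  · rw [integral_zero] at hlim
    exact hlim
  · intro k
    refine aestronglyMeasurable_of_tendsto_ae atTop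
      (f := fun N w => ∏ i ∈ Finset.range N, φ k (stickBreaking w i)) (fun N => ?_) ?_
    · exact (continuous_finsetProd _ fun i _ => (hφc k).comp
        (continuous_stickBreaking_apply i)).aestronglyMeasurable
    · filter_upwards [ae_isStickSequence hθ] with w hw
      obtain ⟨S, hS⟩ := hfac k _ hw
      exact tendsto_prod_range_finprod hS
  · intro k
    filter_upwards [ae_isStickSequence hθ] with w hw
    obtain ⟨S, hS⟩ := hfac k _ hw
    simpa using norm_finprod_le_prod_range (fun i => hφ k _) hS 0
  · filter_upwards [ae_isStickSequence hθ] with w hw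
    rw [Metric.tendsto_nhds]
    intro η hη
    obtain ⟨M, hM⟩ := exists_pow_lt_of_lt_one hη hr1
    have hev : ∀ᶠ k : ℕ in atTop, ∀ i ∈ Finset.range M,
        1 / ((k : ℝ) + 1) < stickBreaking w i / 2 := by
      rw [eventually_all_finset]
      exact fun i _ => eventually_inv_lt (half_pos (hw.pos i))
    filter_upwards [hev] with k hk
    obtain ⟨S, hS⟩ := hfac k _ hw
    rw [dist_zero_right]
    refine lt_of_le_of_lt (norm_finprod_le_prod_range (fun i => hφ k _) hS M) ?_
    refine lt_of_le_of_lt ?_ hM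
    rw [norm_prod]
    calc _ ≤ ∏ _i ∈ Finset.range M, r := Finset.prod_le_prod (fun _ _ => norm_nonneg _)
          fun i hi => hφr k _ (by linarith [hk i hi])
      _ = r ^ M := by rw [Finset.prod_const, Finset.card_range]

theorem tendsto_gemProduct_divisibleFactor {θ : ℝ} (hθ : 0 < θ) {t : ℕ} (ht : 0 < t) :
    Tendsto (fun k : ℕ => gemProduct θ
      (residueMean t fun x m => (divisibleFactor t (1 / ((k : ℝ) + 1)) x m : ℂ)))
      atTop (nhds 0) := by
  have hδ : ∀ k : ℕ, 0 < 1 / ((k : ℝ) + 1) := fun k => by positivity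
  have hK := fun k : ℕ => isCycleFactor_divisibleFactor t (hδ k)
  have ht1 : (1 : ℝ) ≤ t := by exact_mod_cast ht
  have hr0 : 0 ≤ 1 - 1 / (2 * (t : ℝ)) := by
    rw [sub_nonneg, div_le_one (by positivity)]; linarith
  have hr1 : 1 - 1 / (2 * (t : ℝ)) < 1 := by
    have : 0 < 1 / (2 * (t : ℝ)) := by positivity
    linarith
  refine tendsto_gemProduct_zero hθ hr1 (fun k => (hK k).continuous_residueMean)
    (fun k => (hK k).norm_residueMean_le) (fun k x hx => (hK k).residueMean_eq_one ht hx)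
    fun k x hx => ?_
  rw [residueMean_divisibleFactor ht, ramp_eq_one (hδ k) hx, Complex.norm_of_nonneg hr0]

theorem pow_divisible_le_prod (t : ℕ) (s : ℤ) (ht : 0 < t) (hst : IsCoprime s (t : ℤ)) (δ : ℝ)
    (n : ℕ) (m : Multiset ℕ) :
    (1 / 2 : ℝ) ^ (m.map fun ℓ => if t ∣ ℓ then 1 else 0).sum
      ≤ (m.map fun ℓ : ℕ => divisibleFactor t δ ((ℓ : ℝ) / n) (residueIndex s t ℓ)).prod := by
  induction m using Multiset.induction_on with
  | empty => simp
  | cons ℓ m ih =>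
    rw [Multiset.map_cons, Multiset.sum_cons, Multiset.map_cons, Multiset.prod_cons, pow_add]
    have h := divisibleFactor_mem t δ ((ℓ : ℝ) / n) (residueIndex s t ℓ)
    refine mul_le_mul ?_ ih (by positivity) (by linarith [h.1])
    by_cases hd : t ∣ ℓ
    · rw [if_pos hd, pow_one]
      exact h.1
    · rw [if_neg hd, pow_zero, divisibleFactor, if_neg, sub_zero]
      intro hd'
      exact hd ((residueIndex_eq_zero_iff ht hst ℓ).1
        (Nat.eq_zero_of_dvd_of_lt hd' (residueIndex_lt s ht ℓ)))

/-- The number of cycles of length divisible by `t` tends to infinity in probability. -/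
theorem tendsto_measure_divisibleCount_le {θ : ℝ} (hθ : 0 < θ) {t : ℕ} (ht : 0 < t) (M : ℕ) :
    Tendsto (fun n : ℕ => (ewens θ hθ n).toMeasure.real
      {σ : Equiv.Perm (Fin n) | divisibleCount t σ ≤ M}) atTop (nhds 0) := by
  have hst : IsCoprime (1 : ℤ) (t : ℤ) := isCoprime_one_left
  rw [Metric.tendsto_nhds]
  intro η hη
  have hη' : 0 < (1 / 2 : ℝ) ^ M * η := by positivity
  obtain ⟨k, hk⟩ :=
    ((Metric.tendsto_nhds.1 (tendsto_gemProduct_divisibleFactor hθ ht)) _ hη').exists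
  have hδ : 0 < 1 / ((k : ℝ) + 1) := by positivity
  set δ := 1 / ((k : ℝ) + 1) with hδdef
  rw [dist_zero_right] at hk
  filter_upwards [(tendsto_integral_ewens_prod hθ hδ ht hst
    (isCycleFactor_divisibleFactor t hδ)).norm.eventually_lt_const hk] with n hn
  rw [Real.dist_0_eq_abs, abs_of_nonneg measureReal_nonneg]
  set X : Equiv.Perm (Fin n) → ℝ := fun σ => (σ.partition.parts.map fun ℓ : ℕ =>
    divisibleFactor t δ ((ℓ : ℝ) / n) (residueIndex 1 t ℓ)).prod with hX
  have hX0 : ∀ σ, (1 / 2 : ℝ) ^ divisibleCount t σ ≤ X σ := fun σ =>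
    pow_divisible_le_prod t 1 ht hst δ n _
  have hXnn : ∀ σ, 0 ≤ X σ := fun σ => le_trans (by positivity) (hX0 σ)
  have hint : ‖∫ σ : Equiv.Perm (Fin n), (σ.partition.parts.map fun ℓ : ℕ =>
      (divisibleFactor t δ ((ℓ : ℝ) / n) (residueIndex 1 t ℓ) : ℂ)).prod
        ∂(ewens θ hθ n).toMeasure‖ = ∫ σ, X σ ∂(ewens θ hθ n).toMeasure := by
    rw [← Complex.norm_of_nonneg (integral_nonneg hXnn), ← integral_complex_ofReal]
    congr 2
    funext σ
    simp only [hX]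
    rw [← Complex.ofRealHom_eq_coe, map_multiset_prod, Multiset.map_map]
    rfl
  rw [hint] at hn
  have hmarkov := mul_meas_ge_le_integral_of_nonneg (μ := (ewens θ hθ n).toMeasure)
    (ae_of_all _ hXnn) (Integrable.of_finite) ((1 / 2 : ℝ) ^ M)
  have hsub : (ewens θ hθ n).toMeasure.real {σ : Equiv.Perm (Fin n) | divisibleCount t σ ≤ M}
      ≤ (ewens θ hθ n).toMeasure.real {σ | (1 / 2 : ℝ) ^ M ≤ X σ} :=
    measureReal_mono fun σ hσ => le_trans
      (pow_le_pow_of_le_one (by norm_num) (by norm_num) hσ) (hX0 σ)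
  have h3 := (mul_le_mul_of_nonneg_left hsub (by positivity : (0 : ℝ) ≤ (1 / 2) ^ M)).trans hmarkov
  exact lt_of_mul_lt_mul_left (h3.trans_lt hn) (by positivity)

/-! ### Divergence in distribution -/

theorem tendstoInDistribution_top {Ω' : ℕ → Type*} [∀ n, MeasurableSpace (Ω' n)]
    {μ : ∀ n, Measure (Ω' n)} [∀ n, IsProbabilityMeasure (μ n)] {Ω : Type*} [MeasurableSpace Ω]
    {P : Measure Ω} [IsProbabilityMeasure P] {X : ∀ n, Ω' n → EReal} {Z : Ω → EReal}
    (hX : ∀ n, AEMeasurable (X n) (μ n)) (hZ : ∀ᵐ ω ∂P, Z ω = ⊤)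
    (h : ∀ a : ℝ, Tendsto (fun n => μ n {ω | X n ω ≤ a}) atTop (nhds 0)) :
    TendstoInDistribution X atTop Z μ P where
  forall_aemeasurable := hX
  aemeasurable_limit := (aemeasurable_const (b := (⊤ : EReal))).congr
    (hZ.mono fun _ h => h.symm)
  tendsto := by
    refine tendsto_of_forall_isOpen_le_liminf_nat' fun G hG => ?_
    simp only [ProbabilityMeasure.coe_mk]
    have hmap : P.map Z = Measure.dirac (⊤ : EReal) := by
      rw [Measure.map_congr (g := fun _ => (⊤ : EReal)) hZ, Measure.map_const]
      simp
    rw [hmap, Measure.dirac_apply' _ hG.measurableSet]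
    by_cases hT : (⊤ : EReal) ∈ G
    · obtain ⟨a, -, ha⟩ := EReal.nhds_top_basis.mem_iff.1 (hG.mem_nhds hT)
      rw [Set.indicator_of_mem hT, Pi.one_apply]
      have h1 : Tendsto (fun n => 1 - μ n {ω | X n ω ≤ a}) atTop (nhds 1) := by
        have := ENNReal.Tendsto.sub (tendsto_const_nhds (x := (1 : ℝ≥0∞))) (h a)
          (Or.inl ENNReal.one_ne_top)
        simpa using this
      rw [← h1.liminf_eq]
      refine liminf_le_liminf (Eventually.of_forall fun n => ?_)
      rw [Measure.map_apply_of_aemeasurable (hX n) hG.measurableSet, tsub_le_iff_right]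
      calc (1 : ℝ≥0∞) = μ n Set.univ := measure_univ.symm
        _ ≤ μ n ((X n ⁻¹' G) ∪ {ω | X n ω ≤ a}) := measure_mono fun ω _ => by
          rcases le_or_gt (X n ω) a with h2 | h2
          · exact Or.inr h2
          · exact Or.inl (ha h2)
        _ ≤ _ := measure_union_le _ _
    · rw [Set.indicator_of_notMem hT]
      exact zero_le

/-- Almost surely infinitely many of the uniform fractions are equal to `1`. -/
theorem ae_frequently_eq_one {Ω : Type*} [MeasurableSpace Ω] {P : Measure Ω}
    [IsProbabilityMeasure P] {t : ℕ} (ht : 0 < t) {U : ℕ → Ω → ℝ}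
    (hU : ∀ i, HasLaw (U i) (uniformFractions t) P) (hUindep : iIndepFun U P) :
    ∀ᵐ ω ∂P, ∃ᶠ i in atTop, U i ω = 1 := by
  let V : ℕ → Ω → ℝ := fun i => (hU i).aemeasurable.mk (U i)
  have hV : ∀ i, Measurable (V i) := fun i => (hU i).aemeasurable.measurable_mk
  have hUV : ∀ i, U i =ᵐ[P] V i := fun i => (hU i).aemeasurable.ae_eq_mk
  have hVindep : iIndepFun V P := (iIndepFun_congr hUV).1 hUindep
  have hms : ∀ i, MeasurableSet (V i ⁻¹' {1}) := fun i => hV i (measurableSet_singleton 1)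
  have hind : iIndepSet (fun i => V i ⁻¹' {1}) P := by
    rw [iIndepSet_iff_meas_biInter hms]
    exact fun S => hVindep.measure_inter_preimage_eq_mul S fun i _ => measurableSet_singleton 1
  have hpos : uniformFractions t {1} ≠ 0 := by
    have ht' : (t : ℝ) ≠ 0 := by exact_mod_cast ht.ne'
    rw [uniformFractions, Ne, uniformOn_eq_zero_iff ((Set.finite_Icc 1 t).image _),
      ← Set.not_nonempty_iff_eq_empty, not_not]
    exact ⟨1, ⟨t, ⟨ht, le_rfl⟩, div_self ht'⟩, rfl⟩
  have hmeas : ∀ i, P (V i ⁻¹' {1}) = uniformFractions t {1} := fun i => by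
    rw [← (hU i).map_eq, Measure.map_congr (hUV i), Measure.map_apply (hV i)
      (measurableSet_singleton 1)]
  have hlim := measure_limsup_eq_one hms hind (by
    simp only [hmeas]
    exact ENNReal.tsum_const_eq_top_of_ne_zero hpos)
  have hae : ∀ᵐ ω ∂P, ω ∈ limsup (fun i => V i ⁻¹' {1}) atTop :=
    (prob_compl_eq_zero_iff (MeasurableSet.measurableSet_limsup hms)).2 hlim
  filter_upwards [hae, ae_all_iff.2 hUV] with ω hω hω'
  rw [mem_limsup_iff_frequently_mem] at hω
  exact hω.mono fun i hi => (hω' i).trans hi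

/-! ### Test functions -/

theorem coe_ofReal_sub_coe_ofReal {a b : ℝ} (ha : 0 ≤ a) (hb : 0 ≤ b) :
    ((ENNReal.ofReal a : ℝ≥0∞) : EReal) - ((ENNReal.ofReal b : ℝ≥0∞) : EReal)
      = ((a - b : ℝ) : EReal) := by
  rw [EReal.coe_ennreal_ofReal, EReal.coe_ennreal_ofReal, max_eq_left ha, max_eq_left hb,
    EReal.coe_sub]

theorem ofReal_max_zero (x : ℝ) : ENNReal.ofReal (max x 0) = ENNReal.ofReal x := by
  rcases le_total x 0 with h | h
  · rw [max_eq_right h, ENNReal.ofReal_zero, ENNReal.ofReal_of_nonpos h]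
  · rw [max_eq_left h]

theorem IsCycleSummand.sub {t : ℕ} {ε : ℝ} {G H : ℝ → ℕ → ℝ} (hG : IsCycleSummand t ε G)
    (hH : IsCycleSummand t ε H) : IsCycleSummand t ε fun x m => G x m - H x m where
  periodic x m := by simp only [hG.periodic x m, hH.periodic x m]
  continuous r := (hG.continuous r).sub (hH.continuous r)
  eq_zero x hx r := by rw [hG.eq_zero x hx, hH.eq_zero x hx, sub_zero]

theorem sum_cycleCount_mul {n : ℕ} (σ : Equiv.Perm (Fin n)) :
    ∑ j ∈ Finset.Icc 1 n, cycleCount j σ * j = n := by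
  have h := sum_map_parts σ (fun j => j)
  rw [Multiset.map_id', (mem_partitionMultisets.1 (parts_partition_mem σ)).2] at h
  simpa using h.symm

/-- Few cycles are large enough to contribute, so the sum over the cycles is bounded. -/
theorem IsCycleSummand.exists_sum_le {t : ℕ} {ε : ℝ} {G : ℝ → ℕ → ℝ} (hG : IsCycleSummand t ε G)
    (hε : 0 < ε) (ht : 0 < t) (s : ℤ) :
    ∃ C : ℝ, 0 ≤ C ∧ ∀ (n : ℕ) (σ : Equiv.Perm (Fin n)),
      (σ.partition.parts.map fun ℓ : ℕ => G ((ℓ : ℝ) / n) (residueIndex s t ℓ)).sum ≤ C := by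
  have hcont : Continuous fun x => fun r : Fin t => G x r := continuous_pi fun r => hG.continuous r
  obtain ⟨C, hC⟩ := isCompact_Icc.exists_bound_of_continuousOn
    (hcont.continuousOn (s := Set.Icc 0 1))
  have hC0 : 0 ≤ C := (norm_nonneg _).trans (hC 0 (by simp))
  have hlin : ∀ x ∈ Set.Icc (0 : ℝ) 1, ∀ m < t, G x m ≤ C / ε * x := by
    intro x hx m hm
    rcases le_or_gt x ε with h | h
    · rw [hG.eq_zero x h]
      exact mul_nonneg (by positivity) hx.1
    · have h1 : G x m ≤ C := (le_abs_self _).trans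
        ((norm_le_pi_norm (fun r : Fin t => G x r) ⟨m, hm⟩).trans (hC x hx))
      refine h1.trans ?_
      rw [div_mul_eq_mul_div, le_div_iff₀ hε]
      exact mul_le_mul_of_nonneg_left h.le hC0
  refine ⟨C / ε, by positivity, fun n σ => ?_⟩
  rw [sum_map_parts]
  calc ∑ j ∈ Finset.Icc 1 n, cycleCount j σ • G ((j : ℝ) / n) (residueIndex s t j)
      ≤ ∑ j ∈ Finset.Icc 1 n, C / ε / n * (cycleCount j σ * j : ℕ) := by
        refine Finset.sum_le_sum fun j hj => ?_
        have hjn := (Finset.mem_Icc.1 hj).2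
        have h := hlin ((j : ℝ) / n) ⟨by positivity,
          div_le_one_of_le₀ (by exact_mod_cast hjn) (by positivity)⟩ _ (residueIndex_lt s ht j)
        rw [nsmul_eq_mul]
        refine (mul_le_mul_of_nonneg_left h (by positivity)).trans (le_of_eq ?_)
        push_cast
        ring
    _ = C / ε / n * n := by
        rw [← Finset.mul_sum, ← Nat.cast_sum, sum_cycleCount_mul]
    _ ≤ C / ε := by
        rcases Nat.eq_zero_or_pos n with rfl | hn
        · simp only [Nat.cast_zero, mul_zero]
          positivity
        · rw [div_mul_cancel₀ _ (by exact_mod_cast hn.ne')]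

theorem ofReal_mul_divisibleCount_le_lintegral (f : ℝ → ℝ) (s : ℤ) {t : ℕ} (ht : 0 < t) {n : ℕ}
    (σ : Equiv.Perm (Fin n)) :
    ENNReal.ofReal (f 0) * divisibleCount t σ
      ≤ ∫⁻ x, ENNReal.ofReal (f x) ∂(eigenProcess ((s : ℝ) / t) n σ) := by
  have ht' : (t : ℝ) ≠ 0 := by exact_mod_cast ht.ne'
  rw [lintegral_eigenProcess, divisibleCount, sum_map_parts, Nat.cast_sum, Finset.mul_sum]
  refine Finset.sum_le_sum fun j hj => ?_
  by_cases hd : t ∣ j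
  · obtain ⟨d, rfl⟩ := hd
    have hd' : (d : ℝ) ≠ 0 := by
      have := (Finset.mem_Icc.1 hj).1
      rintro h
      have : d = 0 := by exact_mod_cast h
      subst this
      omega
    rw [if_pos (dvd_mul_right t d), smul_eq_mul, mul_one, mul_comm]
    refine mul_le_mul_right (le_trans (le_of_eq ?_) (ENNReal.le_tsum (s * d))) _
    congr 2
    push_cast
    field_simp
    simp
  · simp [hd]

section LimitPoints

variable {θ : ℝ} {t : ℕ} {f : ℝ → ℝ} {Ω : Type*} [MeasurableSpace Ω] {P : Measure Ω}
  {L U : ℕ → Ω → ℝ}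

theorem ae_exists_eq_div (ht : 0 < t) (hU : ∀ i, HasLaw (U i) (uniformFractions t) P) :
    ∀ᵐ ω ∂P, ∀ i, ∃ m ∈ Finset.Icc 1 t, U i ω = (m : ℝ) / t := by
  refine ae_all_iff.2 fun i => ?_
  have h := ae_uniformFractions ht
  rw [← (hU i).map_eq] at h
  exact ae_of_ae_map (hU i).aemeasurable h

/-- The integral of a nonnegative test function that vanishes at `0` against the limit process. -/
theorem ae_lintegral_limitProcess (hθ : 0 < θ) (ht : 0 < t) {A : ℝ} (hA0 : 0 < A)
    (hf : Continuous f) (hA : ∀ x, A ≤ |x| → f x = 0) (h0 : f 0 = 0) (hf0 : ∀ x, 0 ≤ f x)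
    (hL : HasLaw (fun ω i => L i ω) (poissonDirichlet θ) P)
    (hU : ∀ i, HasLaw (U i) (uniformFractions t) P) :
    ∀ᵐ ω ∂P, (Summable fun i => cyclePointSum f t (1 / (t * A)) (L i ω) (fractionIndex t (U i ω))) ∧
      ∫⁻ x, ENNReal.ofReal (f x) ∂(limitProcess (fun i => L i ω) (fun i => U i ω))
        = ENNReal.ofReal
          (∑' i, cyclePointSum f t (1 / (t * A)) (L i ω) (fractionIndex t (U i ω))) := by
  have hε : 0 < 1 / (t * A) := by positivity
  have hG := isCycleSummand_cyclePointSum hf ht hA0 hA h0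
  filter_upwards [ae_exists_eq_div ht hU, ae_poissonDirichlet hθ hε hL,
    hG.exists_forall_eq_zero hθ hε hL] with ω hUω hLω hω
  obtain ⟨N, hN⟩ := hω
  have hs : Summable fun i => cyclePointSum f t (1 / (t * A)) (L i ω) (fractionIndex t (U i ω)) :=
    summable_of_ne_finset_zero fun i hi => hN i hi _
  exact ⟨hs, lintegral_limitProcess_ofReal ht hA0 hA h0 hf0 hLω.1 hUω hs⟩

theorem ae_lintegral_neg_ne_top (hθ : 0 < θ) (ht : 0 < t) (hf : Continuous f)
    (hfc : HasCompactSupport f) (h0 : 0 ≤ f 0)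
    (hL : HasLaw (fun ω i => L i ω) (poissonDirichlet θ) P)
    (hU : ∀ i, HasLaw (U i) (uniformFractions t) P) :
    ∀ᵐ ω ∂P,
      ∫⁻ x, ENNReal.ofReal (-f x) ∂(limitProcess (fun i => L i ω) (fun i => U i ω)) ≠ ⊤ := by
  obtain ⟨A, hA0, hA⟩ := exists_pos_forall_le_abs hfc
  have h := ae_lintegral_limitProcess (f := fun x => max (-f x) 0) hθ ht hA0 (by fun_prop)
    (fun x hx => by simp [hA x hx]) (by simpa using h0) (fun x => le_max_right _ _) hL hU
  filter_upwards [h] with ω hω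
  simp only [ofReal_max_zero] at hω
  rw [hω.2]
  exact ENNReal.ofReal_ne_top

theorem ae_lintegral_eq_top [IsProbabilityMeasure P] (ht : 0 < t) (h0 : 0 < f 0)
    (hU : ∀ i, HasLaw (U i) (uniformFractions t) P) (hUindep : iIndepFun U P) :
    ∀ᵐ ω ∂P,
      ∫⁻ x, ENNReal.ofReal (f x) ∂(limitProcess (fun i => L i ω) (fun i => U i ω)) = ⊤ := by
  filter_upwards [ae_frequently_eq_one ht hU hUindep] with ω hω
  rw [lintegral_limitProcess]
  by_contra hne
  have h := ENNReal.tendsto_atTop_zero_of_tsum_ne_top hne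
  have hpos : 0 < ENNReal.ofReal (f 0) := ENNReal.ofReal_pos.2 h0
  obtain ⟨i, hi1, hi2⟩ := (hω.and_eventually (h.eventually_lt_const hpos)).exists
  refine absurd hi2 (not_lt.2 (le_trans (le_of_eq ?_) (ENNReal.le_tsum (-1 : ℤ))))
  rw [hi1]
  simp

end LimitPoints

section Convergence

variable {θ : ℝ} (hθ : 0 < θ) {s : ℤ} {t : ℕ} {f : ℝ → ℝ} {Ω : Type*} [MeasurableSpace Ω]
  {P : Measure Ω} [IsProbabilityMeasure P] {L U : ℕ → Ω → ℝ}

/-- A test function that vanishes at `0` only sees the finitely many large cycles. -/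
theorem tendstoInDistribution_of_apply_zero_eq (ht : 0 < t) (hst : IsCoprime s (t : ℤ))
    (hL : HasLaw (fun ω i => L i ω) (poissonDirichlet θ) P)
    (hU : ∀ i, HasLaw (U i) (uniformFractions t) P) (hUindep : iIndepFun U P)
    (hLU : IndepFun (fun ω i => L i ω) (fun ω i => U i ω) P)
    (hf : Continuous f) (hfc : HasCompactSupport f) (h0 : f 0 = 0) :
    TendstoInDistribution
      (fun (n : ℕ) (σ : Equiv.Perm (Fin n)) => extIntegral (eigenProcess ((s : ℝ) / t) n σ) f) atTop
      (fun ω => extIntegral (limitProcess (fun i => L i ω) (fun i => U i ω)) f)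
      (fun n => (ewens θ hθ n).toMeasure) P := by
  obtain ⟨A, hA0, hA⟩ := exists_pos_forall_le_abs hfc
  have hε : 0 < 1 / (t * A) := by positivity
  set fp := fun x => max (f x) 0 with hfp
  set fm := fun x => max (-f x) 0 with hfm
  have hfpc : Continuous fp := by fun_prop
  have hfmc : Continuous fm := by fun_prop
  have hAp : ∀ x, A ≤ |x| → fp x = 0 := fun x hx => by simp [hfp, hA x hx]
  have hAm : ∀ x, A ≤ |x| → fm x = 0 := fun x hx => by simp [hfm, hA x hx]
  have hp0 : fp 0 = 0 := by simp [hfp, h0]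
  have hm0 : fm 0 = 0 := by simp [hfm, h0]
  have hpn : ∀ x, 0 ≤ fp x := fun x => le_max_right _ _
  have hmn : ∀ x, 0 ≤ fm x := fun x => le_max_right _ _
  have hG := (isCycleSummand_cyclePointSum hfpc ht hA0 hAp hp0).sub
    (isCycleSummand_cyclePointSum hfmc ht hA0 hAm hm0)
  have hep : ∀ x, ENNReal.ofReal (f x) = ENNReal.ofReal (fp x) := fun x => (ofReal_max_zero _).symm
  have hem : ∀ x, ENNReal.ofReal (-f x) = ENNReal.ofReal (fm x) := fun x => (ofReal_max_zero _).symm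
  have hmain := (tendstoInDistribution_cycle_sum hG hθ hε ht hst hL hU hUindep hLU).continuous_comp
    continuous_coe_real_ereal
  refine hmain.congr (fun n => ae_of_all _ fun σ => ?_) ?_
  · simp only [extIntegral, hep, hem, Function.comp_apply]
    rw [lintegral_eigenProcess_ofReal s ht hA0 hAp hp0 hpn,
      lintegral_eigenProcess_ofReal s ht hA0 hAm hm0 hmn, coe_ofReal_sub_coe_ofReal,
      Multiset.sum_map_sub]
    · exact Multiset.sum_nonneg (by simpa using fun _ _ => cyclePointSum_nonneg hpn _ _ _ _)
    · exact Multiset.sum_nonneg (by simpa using fun _ _ => cyclePointSum_nonneg hmn _ _ _ _)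
  · filter_upwards [ae_lintegral_limitProcess hθ ht hA0 hfpc hAp hp0 hpn hL hU,
      ae_lintegral_limitProcess hθ ht hA0 hfmc hAm hm0 hmn hL hU] with ω hωp hωm
    simp only [extIntegral, hep, hem, Function.comp_apply]
    rw [hωp.2, hωm.2,
      coe_ofReal_sub_coe_ofReal (tsum_nonneg fun _ => cyclePointSum_nonneg hpn _ _ _ _)
      (tsum_nonneg fun _ => cyclePointSum_nonneg hmn _ _ _ _), hωp.1.tsum_sub hωm.1]

/-- If `f 0 > 0`, then the mass at `0` of the cycles of length divisible by `t` dominates. -/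
theorem tendstoInDistribution_of_apply_zero_pos (ht : 0 < t)
    (hL : HasLaw (fun ω i => L i ω) (poissonDirichlet θ) P)
    (hU : ∀ i, HasLaw (U i) (uniformFractions t) P) (hUindep : iIndepFun U P)
    (hf : Continuous f) (hfc : HasCompactSupport f) (h0 : 0 < f 0) :
    TendstoInDistribution
      (fun (n : ℕ) (σ : Equiv.Perm (Fin n)) => extIntegral (eigenProcess ((s : ℝ) / t) n σ) f) atTop
      (fun ω => extIntegral (limitProcess (fun i => L i ω) (fun i => U i ω)) f)
      (fun n => (ewens θ hθ n).toMeasure) P := by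
  refine tendstoInDistribution_top (fun n => measurable_from_top.aemeasurable) ?_ fun a => ?_
  · filter_upwards [ae_lintegral_eq_top (L := L) ht h0 hU hUindep,
      ae_lintegral_neg_ne_top hθ ht hf hfc h0.le hL hU] with ω hω1 hω2
    rw [extIntegral, hω1, EReal.coe_ennreal_top]
    lift ∫⁻ x, ENNReal.ofReal (-f x) ∂(limitProcess (fun i => L i ω) (fun i => U i ω)) to NNReal
      using hω2 with b
    exact EReal.top_sub_coe b
  · obtain ⟨A, hA0, hA⟩ := exists_pos_forall_le_abs hfc
    have hε : 0 < 1 / (t * A) := by positivity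
    set fm := fun x => max (-f x) 0 with hfm
    have hfmc : Continuous fm := by fun_prop
    have hAm : ∀ x, A ≤ |x| → fm x = 0 := fun x hx => by simp [hfm, hA x hx]
    have hm0 : fm 0 = 0 := by simpa [hfm] using h0.le
    have hmn : ∀ x, 0 ≤ fm x := fun x => le_max_right _ _
    have hem : ∀ x, ENNReal.ofReal (-f x) = ENNReal.ofReal (fm x) :=
      fun x => (ofReal_max_zero _).symm
    obtain ⟨C, hC0, hC⟩ :=
      (isCycleSummand_cyclePointSum hfmc ht hA0 hAm hm0).exists_sum_le hε ht s
    have hlim := ENNReal.tendsto_ofReal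
      (tendsto_measure_divisibleCount_le hθ ht ⌈(a + C) / f 0⌉₊)
    rw [ENNReal.ofReal_zero] at hlim
    refine tendsto_of_tendsto_of_tendsto_of_le_of_le tendsto_const_nhds hlim
      (fun n => zero_le) fun n => ?_
    refine le_of_le_of_eq ?_ (ofReal_measureReal (measure_ne_top _ _)).symm
    refine measure_mono fun σ hσ => ?_
    have hlow : ((f 0 * divisibleCount t σ - C : ℝ) : EReal)
        ≤ extIntegral (eigenProcess ((s : ℝ) / t) n σ) f := by
      rw [← coe_ofReal_sub_coe_ofReal (by positivity) hC0, extIntegral]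
      refine EReal.sub_le_sub ?_ ?_
      · rw [EReal.coe_ennreal_le_coe_ennreal_iff, ENNReal.ofReal_mul h0.le, ENNReal.ofReal_natCast]
        exact ofReal_mul_divisibleCount_le_lintegral f s ht σ
      · rw [EReal.coe_ennreal_le_coe_ennreal_iff]
        simp only [hem]
        rw [lintegral_eigenProcess_ofReal s ht hA0 hAm hm0 hmn]
        exact ENNReal.ofReal_le_ofReal (hC n σ)
    have h1 : f 0 * divisibleCount t σ - C ≤ a := EReal.coe_le_coe_iff.1 (hlow.trans hσ)
    have h2 : (divisibleCount t σ : ℝ) ≤ (a + C) / f 0 := by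
      rw [le_div_iff₀ h0]; linarith
    exact Nat.cast_le.1 (h2.trans (Nat.le_ceil _))

end Convergence

theorem extIntegral_neg {μ : Measure ℝ} {f : ℝ → ℝ}
    (h : ∫⁻ x, ENNReal.ofReal (f x) ∂μ ≠ ⊤ ∨ ∫⁻ x, ENNReal.ofReal (-f x) ∂μ ≠ ⊤) :
    -extIntegral μ (fun x => -f x) = extIntegral μ f := by
  simp only [extIntegral, neg_neg]
  rw [EReal.neg_sub, add_comm, sub_eq_add_neg]
  · exact Or.inl (EReal.coe_ennreal_ne_bot _)
  · simpa [or_comm] using h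

theorem theoremT (θ : ℝ) (hθ : 0 < θ) (s : ℤ) (t : ℕ) (ht : 0 < t) (hst : IsCoprime s (t : ℤ))
    {Ω : Type*} [MeasurableSpace Ω] (P : Measure Ω) [IsProbabilityMeasure P]
    (L U : ℕ → Ω → ℝ)
    (hL : HasLaw (fun ω i => L i ω) (poissonDirichlet θ) P)
    (hU : ∀ i, HasLaw (U i) (uniformFractions t) P)
    (hUindep : iIndepFun U P)
    (hLU : IndepFun (fun ω i => L i ω) (fun ω i => U i ω) P)
    (f : ℝ → ℝ) (hf : Continuous f) (hfc : HasCompactSupport f) :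
    (∀ (n : ℕ) (σ : Equiv.Perm (Fin n)),
      Integrable f (eigenProcess ((s : ℝ) / (t : ℝ)) n σ)) ∧
    (∀ᵐ ω ∂P,
      ∫⁻ x, ENNReal.ofReal (f x) ∂(limitProcess (fun i => L i ω) (fun i => U i ω)) ≠ ⊤ ∨
      ∫⁻ x, ENNReal.ofReal (-f x) ∂(limitProcess (fun i => L i ω) (fun i => U i ω)) ≠ ⊤) ∧
    TendstoInDistribution
      (fun (n : ℕ) (σ : Equiv.Perm (Fin n)) =>
        extIntegral (eigenProcess ((s : ℝ) / (t : ℝ)) n σ) f)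
      atTop
      (fun ω => extIntegral (limitProcess (fun i => L i ω) (fun i => U i ω)) f)
      (fun n => (ewens θ hθ n).toMeasure) P := by
  have hfinite : ∀ᵐ ω ∂P,
      ∫⁻ x, ENNReal.ofReal (f x) ∂(limitProcess (fun i => L i ω) (fun i => U i ω)) ≠ ⊤ ∨
      ∫⁻ x, ENNReal.ofReal (-f x) ∂(limitProcess (fun i => L i ω) (fun i => U i ω)) ≠ ⊤ := by
    rcases le_total 0 (f 0) with h0 | h0
    · filter_upwards [ae_lintegral_neg_ne_top hθ ht hf hfc h0 hL hU] with ω hω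
      exact Or.inr hω
    · filter_upwards [ae_lintegral_neg_ne_top (f := fun x => -f x) hθ ht hf.neg hfc.neg
        (neg_nonneg.2 h0) hL hU] with ω hω
      simp only [neg_neg] at hω
      exact Or.inl hω
  have hint := integrable_eigenProcess hf hfc s ht
  refine ⟨hint, hfinite, ?_⟩
  rcases lt_trichotomy (f 0) 0 with h0 | h0 | h0
  · have h := (tendstoInDistribution_of_apply_zero_pos hθ (s := s) (f := fun x => -f x) ht hL hU
      hUindep hf.neg hfc.neg (neg_pos.2 h0)).continuous_comp continuous_neg
    refine h.congr (fun n => ae_of_all _ fun σ => ?_) ?_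
    · exact extIntegral_neg (Or.inl ((hint n σ).lintegral_lt_top.ne))
    · filter_upwards [hfinite] with ω hω
      exact extIntegral_neg hω
  · exact tendstoInDistribution_of_apply_zero_eq hθ ht hst hL hU hUindep hLU hf hfc h0
  · exact tendstoInDistribution_of_apply_zero_pos hθ ht hL hU hUindep hf hfc h0
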